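/- **Setting.** Let $\mathcal X$ be a finite set. For each $\varepsilon>0$ let $L=L(\varepsilon)$ be the generator of an irreducible Markovian jump process on $\mathcal X$ (rows sum to zero) with off-diagonal elements $$L_{ij}=\frac{c_{ij}}{m_i}\,e^{-h_{ij}/\varepsilon}\qquad(i\neq j),$$ where $c_{ij}=c_{ji}>0$, $m_i>0$ and $0<h_{ij}\le+\infty$ do not depend on $\varepsilon$ ($h_{ij}=+\infty$ means $L_{ij}=0$), and assume that there is $V:\mathcal X\to\mathbb R_+$ with $V_i+h_{ij}=V_j+h_{ji}$ for all $i,j$. An edge is a pair $\{a,b\}$ with $a\ne b$ and $h_{ab}<\infty$; its height is $V_{(a,b)}=V_a+h_{ab}$. The height of a path $i\to k_1\to\dots\to k_p\to j$ is $h_{ik_1\dots k_pj}=\max_q\,(h_{ik_1}-h_{k_1i}+\dots+h_{k_qk_{q+1}})$; $H(i,j)$ is the minimal height of a path from $i$ to $j$, and $H(A,B)=\min_{a\in A,b\in B}H(a,b)$. Let a finite group $G$ act on $\mathcal X$ so that $L_{g(a)g(b)}=L_{ab}$ for all $g,a,b,\varepsilon$, and let $A_1,\dots,A_{n_G}$ be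 the orbits; $V$ is constant on each orbit. **Representation.** Let $\rho$ be an irreducible complex representation of $G$ of dimension $d\ge2$ with character $\chi$. Let $(\pi(g)f)_a=f_{g(a)}$ on $\mathbb C^{\mathcal X}$, $P=\frac d{|G|}\sum_{g}\overline{\chi(g)}\,\pi(g)$ and $P_i=\mathbf 1_{A_i}P$. Then $P\mathbb C^{\mathcal X}=\bigoplus_iP_i\mathbb C^{\mathcal X}$ is invariant under $L$; $L^{(p)}$ is the restriction of $L$ to $P\mathbb C^{\mathcal X}$ and $L_{ij}:P_j\mathbb C^{\mathcal X}\to P_i\mathbb C^{\mathcal X}$ are its blocks. The orbit $A_i$ is *active* if $\operatorname{Tr}P_i>0$. Let $h^*(i,j)=\min\{h_{ab}:a\in A_i,b\in A_j\}$. The successor $s(i)$ of $i$ is the orbit $j\ne i$ that minimises $h^*(i,j)$ (unique under assumption 2; if there is only one orbit it has no successor). We say that $i$ is *at the bottom of a cycle* if $s(s(i))=i$ and $V_{A_i}<V_{A_{s(i)}}$. **Assumptions.** 1. (Metastable order of orbits.) The orbits can be numbered so that, with $\mathcal M_k=A_1\cup\dots\cup A_k$, for some $\theta>0$ and all $k=2,\dots,n_G$,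 $H(A_k,\mathcal M_{k-1})\le\min_{i<k}H(A_i,\mathcal M_k\setminus A_i)-\theta$, and there is an edge $e^*(k)$ such that an edge $\{a,b\}$ satisfies $V_{(a,b)}=H(A_k,\mathcal M_{k-1})+V_{A_k}$ if and only if $\{g(a),g(b)\}=e^*(k)$ for some $g\in G$. 2. (No accidental degeneracy.) If $h_{a_1b_1}=h_{a_2b_2}<\infty$, then $g(\{a_1,b_1\})=\{a_2,b_2\}$ for some $g\in G$. 3. Whenever $i$ is at the bottom of a cycle and $j=s(i)$, the block $L_{jj}$ is invertible for small $\varepsilon$, and the Schur complement $\Sigma_i=L_{ii}-L_{ij}L_{jj}^{-1}L_{ji}$ has the same leading exponents as $L_{ii}$, in every direction: there is a constant $K$ such that $K^{-1}\|L_{ii}v\|\le\|\Sigma_iv\|\le K\|L_{ii}v\|$ for all small $\varepsilon>0$ and all $v\in P_i\mathbb C^{\mathcal X}$. **Theorem (Eigenvalues for representations of dimension larger than 1).** Under assumptions 1, 2 and 3 there are $\theta>0$, $C>0$ and $\varepsilon_0>0$ such that for all $0<\varepsilon<\varepsilon_0$ the following holds. Let $\mathcal S$ be the multiset consisting of * the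 eigenvalues of $L_{ii}-L_{ij}L_{jj}^{-1}L_{ji}$, $j=s(i)$, for all orbits $i$ at the bottom of a cycle such that $s(i)$ is active, and * the eigenvalues of all other diagonal blocks $L_{ii}$, all counted with algebraic multiplicity. Then the eigenvalues $\lambda$ of $L^{(p)}$, counted with algebraic multiplicity, can be matched one-to-one with the elements $\mu$ of $\mathcal S$ in such a way that $|\lambda-\mu|\le C\,e^{-\theta/\varepsilon}\,|\mu|$ for every matched pair. -/

import Mathlib

open scoped Topology
open MulAction

noncomputable section

/-! ## Reversible jump processes with Arrhenius rates -/

/-- The data of a family (indexed by `ε > 0`) of irreducible reversible Markovian jump processes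
on `X`, with rates `(c i j / m i) * exp (- h i j / ε)` for `i ≠ j`.  The value `h i j = ⊤` means
that there is no transition from `i` to `j`; by convention `h i i = ⊤`, the diagonal of the
generator being fixed by the requirement that its rows sum to zero. -/
structure JumpData (X : Type*) where
  c : X → X → ℝ
  m : X → ℝ
  h : X → X → EReal
  V : X → ℝ
  c_pos : ∀ i j, 0 < c i j
  c_symm : ∀ i j, c i j = c j i
  m_pos : ∀ i, 0 < m i
  h_pos : ∀ i j, 0 < h i j
  h_self : ∀ i, h i i = ⊤
  V_nonneg : ∀ i, 0 ≤ V i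
  /-- Reversibility with respect to the measure `m * exp (- V / ε)`. -/
  balance : ∀ i j, (V i : EReal) + h i j = (V j : EReal) + h j i
  irreducible : ∀ i j, Relation.ReflTransGen (fun a b => h a b ≠ ⊤) i j

namespace JumpData

variable {X : Type*} (S : JumpData X)

/-- The transition rate `(c i j / m i) * exp (- h i j / ε)`, with `exp (-∞) = 0`. -/
def rate (ε : Set.Ioi (0 : ℝ)) (i j : X) : ℝ :=
  if S.h i j = ⊤ then 0 else S.c i j / S.m i * Real.exp (-(S.h i j).toReal / ε)

/-- The generator `L`: the off-diagonal elements are the rates, and the rows sum to zero. -/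
def generator [Fintype X] [DecidableEq X] (ε : Set.Ioi (0 : ℝ)) : Matrix X X ℝ :=
  fun i j => if i = j then - ∑ k ∈ Finset.univ.erase i, S.rate ε i k else S.rate ε i j

/-- `S.pathHeight i [k₁, …, kₚ]` is the height `h_{i k₁ … kₚ}` of the path `i → k₁ → ⋯ → kₚ`
relative to `i`: the maximum over its steps `k_q → k_{q+1}` of
`h_{i k₁} - h_{k₁ i} + ⋯ + h_{k_{q-1} k_q} - h_{k_q k_{q-1}} + h_{k_q k_{q+1}}`.
It is `⊤` as soon as some step has `h = ⊤`. -/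
def pathHeight : X → List X → EReal
  | _, [] => ⊥
  | i, k :: l => S.h i k ⊔ (S.h i k - S.h k i + pathHeight k l)

/-- The communication height from `i` to `j`: the minimum of the heights of all paths
`i → k₁ → ⋯ → kₚ → j`, `p ≥ 0`. -/
def commHeight (i j : X) : EReal := ⨅ l : List X, S.pathHeight i (l ++ [j])

/-- The communication height between two sets of states. -/
def setCommHeight (A B : Set X) : EReal := ⨅ a ∈ A, ⨅ b ∈ B, S.commHeight a b

end JumpData

/-! ## Symmetry -/

/-- A jump process on `X` whose generator is invariant under the action of a group `G`. -/
structure SymJumpData (G X : Type*) [Group G] [MulAction G X] [Fintype X] [DecidableEq X]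
    extends JumpData X where
  invariant : ∀ (ε : Set.Ioi (0 : ℝ)) (g : G) (a b : X),
    toJumpData.generator ε (g • a) (g • b) = toJumpData.generator ε a b

/-- The set `X / G` of orbits. -/
abbrev Orbits (G X : Type*) [Group G] [MulAction G X] : Type _ := orbitRel.Quotient G X

namespace SymJumpData

variable {G X : Type*} [Group G] [MulAction G X] [Fintype X] [DecidableEq X]
  (S : SymJumpData G X)

/-- Metastable order of orbits, with gap `θ`: the orbits can be ordered as `A 0 ≺ A 1 ≺ ⋯` so that,
with `M k = A 0 ∪ ⋯ ∪ A k`, for every `k` which is not the first index,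
`H(A k, M (k-1)) ≤ min_{i<k} H(A i, M k \ A i) - θ`, and there is, up to the action of `G`, exactly
one (undirected) edge of the process at height `H(A k, M (k-1)) + V_{A k}`. -/
def HasMetastableOrder (θ : ℝ) : Prop :=
  ∃ A : Fin (Nat.card (Orbits G X)) ≃ Orbits G X,
    ∀ k : Fin (Nat.card (Orbits G X)), 0 < k.val →
      (∀ i < k,
        S.setCommHeight (A k).orbit (⋃ l < k, (A l).orbit) + (θ : EReal) ≤
          S.setCommHeight (A i).orbit ((⋃ l ≤ k, (A l).orbit) \ (A i).orbit)) ∧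
      ∃ x y : X, S.h x y ≠ ⊤ ∧
        ∀ u ∈ (A k).orbit, ∀ a b : X, S.h a b ≠ ⊤ →
          (S.setCommHeight (A k).orbit (⋃ l < k, (A l).orbit) + (S.V u : EReal)
              = (S.V a : EReal) + S.h a b ↔
            ∃ g : G, s(g • a, g • b) = s(x, y))

/-- Absence of accidental degeneracy: two edges with the same exponent are related by the group. -/
def NoAccidentalDegeneracy : Prop :=
  ∀ a₁ b₁ a₂ b₂ : X, S.h a₁ b₁ ≠ ⊤ → S.h a₁ b₁ = S.h a₂ b₂ →
    ∃ g : G, s(g • a₁, g • b₁) = s(a₂, b₂)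

/-- The minimal exponent `h^*` for direct transitions between two orbits. -/
def hStar (i j : Orbits G X) : EReal := ⨅ a ∈ i.orbit, ⨅ b ∈ j.orbit, S.h a b

/-- `j` realises the infimum of `h^*(i, ·)` over the orbits different from `i`. -/
def IsSuccessor (i j : Orbits G X) : Prop :=
  j ≠ i ∧ ∀ k, k ≠ i → S.hStar i j ≤ S.hStar i k

open Classical in
/-- The successor `s(i)` of an orbit.  (If there is only one orbit, it has no successor, and then
`s(i) = i` by convention.) -/
def succ (i : Orbits G X) : Orbits G X :=
  if H : ∃ j, S.IsSuccessor i j then H.choose else i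

/-- `i` is at the bottom of a cycle of length 2, namely `i → s(i) → i`, of the graph of
successors. -/
def AtBottom (i : Orbits G X) : Prop :=
  S.succ i ≠ i ∧ S.succ (S.succ i) = i ∧
    ∀ a ∈ i.orbit, ∀ b ∈ (S.succ i).orbit, S.V a < S.V b

/-- The generator as a linear operator on `ℂ^X`. -/
def generatorOp (ε : Set.Ioi (0 : ℝ)) : (X → ℂ) →ₗ[ℂ] (X → ℂ) :=
  Matrix.toLin' ((S.generator ε).map (fun x : ℝ => (x : ℂ)))

end SymJumpData

/-! ## Projectors associated with an irreducible representation -/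

section Projectors

variable {G X W : Type*} [Group G] [Fintype G] [MulAction G X]
  [AddCommGroup W] [Module ℂ W]

/-- The permutation operator `π(g)` with matrix elements `π(g)_{ab} = 1` if `g(a) = b`, and `0`
otherwise, that is, `(π(g) f)_a = f_{g(a)}`. -/
def permOp (X : Type*) [MulAction G X] (g : G) : (X → ℂ) →ₗ[ℂ] (X → ℂ) :=
  LinearMap.funLeft ℂ ℂ (fun a : X => g • a)

/-- The projector `P = (d / |G|) ∑ g, conj (χ(g)) π(g)` associated with a representation of
dimension `d` and character `χ`. -/
def isoProj (X : Type*) [MulAction G X] (ρ : Representation ℂ G W) : (X → ℂ) →ₗ[ℂ] (X → ℂ) :=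
  ((Module.finrank ℂ W : ℂ) / (Fintype.card G : ℂ)) •
    ∑ g : G, (starRingEnd ℂ) (LinearMap.trace ℂ W (ρ g)) • permOp X g

open Classical in
/-- Multiplication by the indicator function of an orbit. -/
def orbitInd (i : Orbits G X) : (X → ℂ) →ₗ[ℂ] (X → ℂ) where
  toFun f a := if a ∈ i.orbit then f a else 0
  map_add' f f' := by ext a; by_cases h : a ∈ i.orbit <;> simp [h]
  map_smul' r f := by ext a; by_cases h : a ∈ i.orbit <;> simp [h]

/-- The projector `P_i` associated with the permutations `π_i(g)` induced on the orbit `i`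
(extended by zero outside that orbit). -/
def orbitProj (ρ : Representation ℂ G W) (i : Orbits G X) : (X → ℂ) →ₗ[ℂ] (X → ℂ) :=
  orbitInd i ∘ₗ isoProj X ρ

/-- The subspace `P ℂ^X`. -/
def isoSpace (X : Type*) [MulAction G X] (ρ : Representation ℂ G W) : Submodule ℂ (X → ℂ) :=
  LinearMap.range (isoProj X ρ)

/-- The subspace `P_i ℂ^X`; the space `P ℂ^X` is the direct sum of these over all orbits. -/
def orbitSpace (ρ : Representation ℂ G W) (i : Orbits G X) : Submodule ℂ (X → ℂ) :=
  LinearMap.range (orbitProj ρ i)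

/-- An orbit is active (with respect to the representation) if `Tr P_i > 0`. -/
def IsActive [Fintype X] (ρ : Representation ℂ G W) (i : Orbits G X) : Prop :=
  0 < (LinearMap.trace ℂ (X → ℂ) (orbitProj ρ i)).re

theorem permOp_orbitInd (g : G) (i : Orbits G X) (f : X → ℂ) :
    permOp X g (orbitInd i f) = orbitInd i (permOp X g f) := by
  ext a
  have : g • a ∈ i.orbit ↔ a ∈ i.orbit := by
    rw [orbitRel.Quotient.mem_orbit, orbitRel.Quotient.mem_orbit]
    exact Eq.congr_left (orbitRel.Quotient.quotient_smul_eq (g := g) (a := a))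
  by_cases h : a ∈ i.orbit
  · simp [permOp, orbitInd, LinearMap.funLeft_apply, h, this.2 h]
  · simp [permOp, orbitInd, LinearMap.funLeft_apply, h, mt this.1 h]

theorem isoProj_orbitInd (ρ : Representation ℂ G W) (i : Orbits G X) (f : X → ℂ) :
    isoProj X ρ (orbitInd i f) = orbitInd i (isoProj X ρ f) := by
  simp [isoProj, LinearMap.sum_apply, permOp_orbitInd, map_sum]

end Projectors

/-! ## The restriction of the generator and its blocks -/

namespace SymJumpData

variable {G X W : Type*} [Group G] [Fintype G] [MulAction G X] [Fintype X] [DecidableEq X]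
  [AddCommGroup W] [Module ℂ W] (S : SymJumpData G X)

theorem generatorOp_permOp (ε : Set.Ioi (0 : ℝ)) (g : G) (f : X → ℂ) :
    S.generatorOp ε (permOp X g f) = permOp X g (S.generatorOp ε f) := by
  ext a
  simp only [generatorOp, permOp, LinearMap.funLeft_apply, Matrix.toLin'_apply, Matrix.mulVec,
    dotProduct, Matrix.map_apply]
  refine Fintype.sum_equiv (MulAction.toPerm g : Equiv.Perm X) _ _ fun x => ?_
  rw [MulAction.toPerm_apply, S.invariant]

theorem generatorOp_isoProj (ρ : Representation ℂ G W) (ε : Set.Ioi (0 : ℝ)) (f : X → ℂ) :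
    S.generatorOp ε (isoProj X ρ f) = isoProj X ρ (S.generatorOp ε f) := by
  simp [isoProj, LinearMap.sum_apply, generatorOp_permOp, map_sum]

theorem generatorOp_mem (ρ : Representation ℂ G W) (ε : Set.Ioi (0 : ℝ)) :
    ∀ f ∈ isoSpace X ρ, S.generatorOp ε f ∈ isoSpace X ρ := by
  rintro _ ⟨f, rfl⟩
  exact ⟨S.generatorOp ε f, (S.generatorOp_isoProj ρ ε f).symm⟩

theorem orbitInd_generatorOp_mem (ρ : Representation ℂ G W) (ε : Set.Ioi (0 : ℝ))
    (i j : Orbits G X) (f : orbitSpace ρ j) :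
    orbitInd i (S.generatorOp ε (f : X → ℂ)) ∈ orbitSpace ρ i := by
  obtain ⟨f, x, rfl⟩ := f
  refine ⟨S.generatorOp ε (orbitInd j x), ?_⟩
  simp [orbitProj, ← isoProj_orbitInd, generatorOp_isoProj]

/-- The restriction `L^{(p)}` of the generator to the invariant subspace `P ℂ^X`. -/
def restricted (ρ : Representation ℂ G W) (ε : Set.Ioi (0 : ℝ)) : Module.End ℂ (isoSpace X ρ) :=
  (S.generatorOp ε).restrict (S.generatorOp_mem ρ ε)

/-- The block `L^{(p)}_{ij}` of `L^{(p)}` with respect to the decomposition of `P ℂ^X` into the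
subspaces `P_i ℂ^X`; it maps `f ∈ P_j ℂ^X` to the component of `L f` on the orbit `i`. -/
def block (ρ : Representation ℂ G W) (ε : Set.Ioi (0 : ℝ)) (i j : Orbits G X) :
    orbitSpace (X := X) ρ j →ₗ[ℂ] orbitSpace (X := X) ρ i :=
  LinearMap.codRestrict (orbitSpace ρ i)
    (orbitInd i ∘ₗ S.generatorOp ε ∘ₗ (orbitSpace ρ j).subtype)
    (S.orbitInd_generatorOp_mem ρ ε i j)

/-- The Schur complement `L_ii - L_ij (L_jj)⁻¹ L_ji`. -/
def schur (ρ : Representation ℂ G W) (ε : Set.Ioi (0 : ℝ)) (i j : Orbits G X) :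
    Module.End ℂ (orbitSpace (X := X) ρ i) :=
  S.block ρ ε i i -
    S.block ρ ε i j ∘ₗ (Ring.inverse (S.block ρ ε j j : Module.End ℂ (orbitSpace (X := X) ρ j))) ∘ₗ
      S.block ρ ε j i

end SymJumpData

/-- Two `ε`-dependent operators have leading coefficients with the same exponents: as `ε → 0` they
are comparable, in every direction and up to factors that do not depend on `ε`. -/
def SameLeadingExponents {E : Type*} [NormedAddCommGroup E] [Module ℂ E]
    (B B' : Set.Ioi (0 : ℝ) → Module.End ℂ E) : Prop :=
  ∃ K > (0 : ℝ), ∃ ε₀ > (0 : ℝ), ∀ ε : Set.Ioi (0 : ℝ), (ε : ℝ) < ε₀ →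
    ∀ v : E, ‖B ε v‖ ≤ K * ‖B' ε v‖ ∧ ‖B' ε v‖ ≤ K * ‖B ε v‖

/-- The eigenvalues of an operator, with multiplicities. -/
def eigenvalueMultiset {E : Type*} [AddCommGroup E] [Module ℂ E] [Module.Finite ℂ E]
    (B : Module.End ℂ E) : Multiset ℂ := (LinearMap.charpoly B).roots

namespace SymJumpData

variable {G X W : Type*} [Group G] [Fintype G] [MulAction G X] [Fintype X] [DecidableEq X]
  [AddCommGroup W] [Module ℂ W] (S : SymJumpData G X)

/-- Whenever `i` is at the bottom of a cycle `(i, j)`, `j = s(i)`, of the graph of successors,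
the block `L_jj` is invertible and the Schur complement `L_ii - L_ij (L_jj)⁻¹ L_ji` has the same
leading exponents as `L_ii`. -/
def NondegenerateCycles (ρ : Representation ℂ G W) : Prop :=
  ∀ i : Orbits G X, S.AtBottom i →
    (∃ ε₀ > (0 : ℝ), ∀ ε : Set.Ioi (0 : ℝ), (ε : ℝ) < ε₀ →
      IsUnit (S.block ρ ε (S.succ i) (S.succ i) :
        Module.End ℂ (orbitSpace (X := X) ρ (S.succ i)))) ∧
    SameLeadingExponents (fun ε => S.schur ρ ε i (S.succ i)) (fun ε => S.block ρ ε i i)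

open Classical in
/-- The eigenvalues, with multiplicities, of the Schur complements `L_ii - L_ij (L_jj)⁻¹ L_ji` for
all orbits `i` at the bottom of a cycle for which `j = s(i)` is active. -/
def schurEigenvalues (ρ : Representation ℂ G W) (ε : Set.Ioi (0 : ℝ)) : Multiset ℂ :=
  letI : Fintype (Orbits G X) := Fintype.ofFinite _
  ∑ i : Orbits G X with S.AtBottom i ∧ IsActive ρ (S.succ i),
    eigenvalueMultiset (S.schur ρ ε i (S.succ i))

open Classical in
/-- The eigenvalues, with multiplicities, of all other diagonal blocks `L_ii`. -/
def blockEigenvalues (ρ : Representation ℂ G W) (ε : Set.Ioi (0 : ℝ)) : Multiset ℂ :=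
  letI : Fintype (Orbits G X) := Fintype.ofFinite _
  ∑ i : Orbits G X with ¬ (S.AtBottom i ∧ IsActive ρ (S.succ i)),
    eigenvalueMultiset (S.block ρ ε i i)

end SymJumpData

end

/-! ## Eigenvalue multisets -/

/-! Conjugation by the square root of the reversible measure `m * exp (-V / ε)` turns `-L` into a
symmetric nonnegative operator `A`. The measure is constant on orbits, so on each `P_i ℂ^X` the
conjugation is a scalar and the diagonal blocks and Schur complements keep their spectra. Relative
errors on eigenvalues then follow, by min-max, from relative errors on quadratic forms.

Write `h_i` for the exponent of the exit from the orbit `i`. Every state of the orbit has an exit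
with this exponent, and functions in `P_i ℂ^X` vanish elsewhere, so the diagonal block is at least
`κ_i`, of order `exp (-h_i / ε)` (`le_re_inner_symOp_self`). A matrix element between two orbits is
the geometric mean of two opposite rates, of order `exp (-(h_ab + h_ba) / (2 ε))`. Without
accidental degeneracy, both exponents can be minimal only if the two orbits are each other's
successors. Every other block is exponentially smaller than `√(κ_i κ_j)`.

The blocks inside a cycle `i ↔ j` need not be small and are eliminated. The metastable order forces
`V` to differ on the two orbits (`V_ne_of_cycle`), so one of them, say `i`, is the bottom; the gap
in `V` makes `N = A_jj⁻¹ A_ji` exponentially small. The shear `1 + N` satisfies `N² = 0` and carries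
the direct sum of the Schur complements and the other diagonal blocks to `A` without its small
blocks (`sum_inner_reducedBlock`). Assumption 3 bounds `A_ii` by a multiple of its Schur complement
as forms (`form_le_of_norm_le`), so the neglected blocks are small relative to the reduced form
(`sum_sq_le`, `abs_form_sub_le`). Comparing ordered eigenvalues through `1 + N` and through `1 - N`
gives the matching (`rel_eigenvalueMultiset`); `exists_pairedBounds` supplies the estimates. -/

theorem eigenvalueMultiset_of_basis {ι E : Type*} [Fintype ι] [AddCommGroup E] [Module ℂ E]
    [Module.Finite ℂ E] (b : Module.Basis ι ℂ E) (f : Module.End ℂ E) (μ : ι → ℂ)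
    (h : ∀ i, f (b i) = μ i • b i) : eigenvalueMultiset f = Finset.univ.val.map μ := by
  classical
  have hm : LinearMap.toMatrix b b f = Matrix.diagonal μ := by
    ext i j
    rw [LinearMap.toMatrix_apply, h j]
    by_cases hij : i = j
    · subst hij; simp
    · simp [hij]
  rw [eigenvalueMultiset, ← LinearMap.charpoly_toMatrix f b, hm, Matrix.charpoly_diagonal,
    Polynomial.roots_prod _ _ (by simp [Finset.prod_ne_zero_iff, Polynomial.X_sub_C_ne_zero])]
  simp

theorem eigenvalueMultiset_conj {E F : Type*} [AddCommGroup E] [Module ℂ E] [Module.Finite ℂ E]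
    [AddCommGroup F] [Module ℂ F] [Module.Finite ℂ F] (e : E ≃ₗ[ℂ] F) (f : Module.End ℂ E)
    (f' : Module.End ℂ F) (h : ∀ x, f' (e x) = e (f x)) :
    eigenvalueMultiset f' = eigenvalueMultiset f := by
  have : f' = e.conj f := by
    ext x
    rw [LinearEquiv.conj_apply_apply, ← h, e.apply_symm_apply]
  rw [eigenvalueMultiset, eigenvalueMultiset, this, LinearEquiv.charpoly_conj]

/-! ### Min-max and form inequalities for symmetric operators. -/

section Symmetric

variable {E F : Type*} [NormedAddCommGroup E] [InnerProductSpace ℂ E] [FiniteDimensional ℂ E]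
  [NormedAddCommGroup F] [InnerProductSpace ℂ F] [FiniteDimensional ℂ F] {n : ℕ}

theorem LinearMap.IsSymmetric.eigenvalueMultiset_neg {A : Module.End ℂ E} (hA : A.IsSymmetric)
    (hn : Module.finrank ℂ E = n) :
    eigenvalueMultiset (-A) = Finset.univ.val.map fun i => -(hA.eigenvalues hn i : ℂ) := by
  refine eigenvalueMultiset_of_basis (hA.eigenvectorBasis hn).toBasis _ _ fun i => ?_
  simp [hA.apply_eigenvectorBasis]

theorem LinearMap.IsSymmetric.re_inner_apply_self_eq_sum {A : Module.End ℂ E}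
    (hA : A.IsSymmetric) (hn : Module.finrank ℂ E = n) (x : E) :
    (inner ℂ x (A x)).re =
      ∑ i, hA.eigenvalues hn i * ‖inner ℂ (hA.eigenvectorBasis hn i) x‖ ^ 2 := by
  rw [← (hA.eigenvectorBasis hn).sum_inner_mul_inner x (A x), Complex.re_sum]
  refine Finset.sum_congr rfl fun i _ => ?_
  rw [← hA, hA.apply_eigenvectorBasis, inner_smul_left, ← inner_conj_symm x]
  have := Complex.mul_conj (inner ℂ (hA.eigenvectorBasis hn i) x)
  rw [mul_left_comm, mul_comm ((starRingEnd ℂ) (inner ℂ _ x)), this, Complex.normSq_eq_norm_sq]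
  simp [← Complex.ofReal_pow]

/-- Comparison of the ordered eigenvalues of two symmetric operators through a linear map. -/
theorem LinearMap.IsSymmetric.eigenvalues_le_of_form_le {A : Module.End ℂ E} {B : Module.End ℂ F}
    (hA : A.IsSymmetric) (hB : B.IsSymmetric) (hE : Module.finrank ℂ E = n)
    (hF : Module.finrank ℂ F = n) (hB0 : ∀ y, 0 ≤ (inner ℂ y (B y)).re) (T : E →ₗ[ℂ] F)
    {α β : ℝ} (hα : 0 ≤ α) (hAB : ∀ x, (inner ℂ x (A x)).re ≤ α * (inner ℂ (T x) (B (T x))).re)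
    (hT : ∀ x, ‖T x‖ ^ 2 ≤ β * ‖x‖ ^ 2) (k : Fin n) :
    hA.eigenvalues hE k ≤ α * β * hB.eigenvalues hF k := by
  set a := hA.eigenvalues hE
  set b := hB.eigenvalues hF
  set e := hA.eigenvectorBasis hE
  set f := hB.eigenvectorBasis hF
  have hb : 0 ≤ b k := by
    have := hB0 (f k)
    rw [hB.apply_eigenvectorBasis, inner_smul_right] at this
    simpa [f, b] using this
  -- Courant–Fischer by counting dimensions: `n - 1` linear conditions leave a nonzero `x` in the
  -- span of the `e i` with `i ≤ k` whose image `T x` lies in the span of the `f i` with `i ≥ k`.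
  -- The eigenvalues are in decreasing order.
  let Φ : E →ₗ[ℂ] ({i : Fin n // i ≠ k} → ℂ) := LinearMap.pi fun i =>
    if i.1 < k then (innerSL ℂ (f i)).toLinearMap ∘ₗ T else (innerSL ℂ (e i)).toLinearMap
  have hker : LinearMap.ker Φ ≠ ⊥ := by
    apply LinearMap.ker_ne_bot_of_finrank_lt
    rw [hE, Module.finrank_fintype_fun_eq_card, Fintype.card_subtype_compl]
    have := k.pos
    simp only [Fintype.card_fin, Fintype.card_unique]
    omega
  obtain ⟨x, hx, hx0⟩ := Submodule.exists_mem_ne_zero_of_ne_bot hker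
  have hΦ : ∀ i (hi : i ≠ k), Φ x ⟨i, hi⟩ = 0 := fun i hi => by
    rw [LinearMap.mem_ker.1 hx]; rfl
  have he : ∀ i, k < i → inner ℂ (e i) x = 0 := fun i hi => by
    have := hΦ i hi.ne'
    simpa [Φ, hi.not_gt] using this
  have hf : ∀ i, i < k → inner ℂ (f i) (T x) = 0 := fun i hi => by
    have := hΦ i hi.ne
    simpa [Φ, hi] using this
  have h1 : a k * ‖x‖ ^ 2 ≤ (inner ℂ x (A x)).re := by
    rw [hA.re_inner_apply_self_eq_sum hE, ← e.sum_sq_norm_inner_right, Finset.mul_sum]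
    refine Finset.sum_le_sum fun i _ => ?_
    rcases lt_or_ge k i with hi | hi
    · change _ * ‖inner ℂ (e i) x‖ ^ 2 ≤ _ * ‖inner ℂ (e i) x‖ ^ 2
      rw [he i hi]; simp
    · exact mul_le_mul_of_nonneg_right (hA.eigenvalues_antitone hE hi) (sq_nonneg _)
  have h2 : (inner ℂ (T x) (B (T x))).re ≤ b k * ‖T x‖ ^ 2 := by
    rw [hB.re_inner_apply_self_eq_sum hF, ← f.sum_sq_norm_inner_right, Finset.mul_sum]
    refine Finset.sum_le_sum fun i _ => ?_
    rcases lt_or_ge i k with hi | hi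
    · change _ * ‖inner ℂ (f i) (T x)‖ ^ 2 ≤ _ * ‖inner ℂ (f i) (T x)‖ ^ 2
      rw [hf i hi]; simp
    · exact mul_le_mul_of_nonneg_right (hB.eigenvalues_antitone hF hi) (sq_nonneg _)
  have hxp : 0 < ‖x‖ ^ 2 := by positivity
  refine le_of_mul_le_mul_right ?_ hxp
  calc a k * ‖x‖ ^ 2 ≤ α * (inner ℂ (T x) (B (T x))).re := h1.trans (hAB x)
    _ ≤ α * (b k * (β * ‖x‖ ^ 2)) := by
        refine mul_le_mul_of_nonneg_left (h2.trans ?_) hα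
        exact mul_le_mul_of_nonneg_left (hT x) hb
    _ = _ := by ring

/-- For symmetric operators, `Q ≥ 0` and `‖P x‖ ≤ ‖Q x‖` imply `P ≤ Q`. -/
theorem LinearMap.IsSymmetric.form_le_of_norm_le {P Q : Module.End ℂ E} (hP : P.IsSymmetric)
    (hQ : Q.IsSymmetric) (hQ0 : ∀ x, 0 ≤ (inner ℂ x (Q x)).re) (h : ∀ x, ‖P x‖ ≤ ‖Q x‖) (x : E) :
    (inner ℂ x (P x)).re ≤ (inner ℂ x (Q x)).re := by
  have hD : (P - Q).IsSymmetric := hP.sub hQ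
  set t := hD.eigenvalues rfl
  set e := hD.eigenvectorBasis rfl
  -- If `t > 0` and `P e = Q e + t e` with `e` a unit vector, then `‖P e‖² = ‖Q e‖² + 2 t ⟨e, Q e⟩ +
  -- t² > ‖Q e‖²`.
  have ht : ∀ i, t i ≤ 0 := by
    intro i
    by_contra! hpos
    have h1 : P (e i) = Q (e i) + (t i : ℂ) • e i := by
      have := hD.apply_eigenvectorBasis rfl i
      rw [LinearMap.sub_apply] at this
      exact eq_add_of_sub_eq' this
    have h2 : ‖P (e i)‖ ^ 2 ≤ ‖Q (e i)‖ ^ 2 := by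
      have := h (e i); gcongr
    have h3 : (inner ℂ (Q (e i)) (e i)).re = (inner ℂ (e i) (Q (e i))).re := by rw [hQ]
    rw [h1, norm_add_sq (𝕜 := ℂ), inner_smul_right, norm_smul, e.norm_eq_one] at h2
    simp only [Complex.norm_real, Real.norm_eq_abs, mul_one, sq_abs, RCLike.re_to_complex,
      Complex.re_ofReal_mul, h3] at h2
    nlinarith [hQ0 (e i), mul_nonneg hpos.le (hQ0 (e i)), mul_pos hpos hpos]
  have := hD.re_inner_apply_self_eq_sum rfl x
  have h4 : (inner ℂ x ((P - Q) x)).re ≤ 0 := by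
    rw [this]
    exact Finset.sum_nonpos fun i _ => mul_nonpos_of_nonpos_of_nonneg (ht i) (sq_nonneg _)
  rw [LinearMap.sub_apply, inner_sub_right, Complex.sub_re] at h4
  linarith

end Symmetric

/-! ## Block operators whose large off-diagonal blocks come in pairs -/

section Blocks

variable {ι : Type*} [Fintype ι] {E : ι → Type*} [∀ i, NormedAddCommGroup (E i)]
  [∀ i, InnerProductSpace ℂ (E i)]

/-- The operator on a finite product of spaces with the given blocks. -/
noncomputable def blockOp (A : ∀ i j, E j →ₗ[ℂ] E i) : Module.End ℂ (∀ i, E i) :=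
  LinearMap.pi fun i => ∑ j, A i j ∘ₗ LinearMap.proj j

theorem blockOp_apply (A : ∀ i j, E j →ₗ[ℂ] E i) (x : ∀ i, E i) (i : ι) :
    blockOp A x i = ∑ j, A i j (x j) := by
  simp [blockOp, LinearMap.sum_apply]

/-- A Hermitian family of blocks `A`, a relation `p` that pairs some of the indices, and maps `N`
with `N j i = (A j j)⁻¹ (A j i)` if `p i j`, and `N j i = 0` otherwise. -/
structure PairedBlocks (A N : ∀ i j, E j →ₗ[ℂ] E i) (p : ι → ι → Prop) : Prop where
  symm : ∀ i j (x : E i) (y : E j), inner ℂ x (A i j y) = inner ℂ (A j i x) y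
  right_unique : ∀ i j k, p i j → p i k → j = k
  left_unique : ∀ i j k, p i k → p j k → i = j
  not_chain : ∀ i j k, p i j → ¬ p j k
  apply_N : ∀ i j, p i j → ∀ x, A j j (N j i x) = A j i x
  N_eq_zero : ∀ i j, ¬ p i j → N j i = 0

/-- The Schur complements `A i i - ∑ j, A i j (N j i)`. -/
noncomputable def reducedBlock (A N : ∀ i j, E j →ₗ[ℂ] E i) (i : ι) : Module.End ℂ (E i) :=
  A i i - ∑ j, A i j ∘ₗ N j i

theorem reducedBlock_apply (A N : ∀ i j, E j →ₗ[ℂ] E i) (i : ι) (x : E i) :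
    reducedBlock A N i x = A i i x - ∑ j, A i j (N j i x) := by
  simp [reducedBlock, LinearMap.sum_apply]

namespace PairedBlocks

variable {A N : ∀ i j, E j →ₗ[ℂ] E i} {p : ι → ι → Prop} (h : PairedBlocks A N p)
include h

-- `N² = 0` because pairs never chain; this makes `1 - N` the inverse of the shear `1 + N`.
omit [Fintype ι] in
theorem N_N (i k j : ι) (x : E i) : N j k (N k i x) = 0 := by
  by_cases hik : p i k
  · rw [h.N_eq_zero k j (h.not_chain i k j hik)]; rfl
  · rw [h.N_eq_zero i k hik]; simp

omit [Fintype ι] in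
theorem not_refl (i : ι) : ¬ p i i := fun hi => h.not_chain i i i hi hi

omit [Fintype ι] in
open Classical in
theorem A_N (i k : ι) (x : E i) : A k k (N k i x) = if p i k then A k i x else 0 := by
  split_ifs with hik
  · exact h.apply_N i k hik x
  · rw [h.N_eq_zero i k hik]; simp

open Classical in
theorem sum_paired (i k : ι) (hik : p i k) (x : ∀ i, E i) :
    ∑ j, (if p j k then A k j (x j) else 0) = A k i (x i) := by
  rw [Finset.sum_eq_single i, if_pos hik]
  · intro j _ hj
    rw [if_neg fun hjk => hj (h.left_unique j i k hjk hik)]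
  · simp

theorem reducedBlock_symm (k : ι) : (reducedBlock A N k).IsSymmetric := by
  intro x y
  rw [reducedBlock_apply, reducedBlock_apply, inner_sub_left, inner_sub_right, sum_inner, inner_sum,
    h.symm]
  congr 1
  refine Finset.sum_congr rfl fun j _ => ?_
  by_cases hkj : p k j
  · rw [h.symm, ← h.apply_N k j hkj x, ← h.symm j j, h.apply_N k j hkj, ← h.symm]
  · simp [h.N_eq_zero k j hkj]

open Classical in
theorem reducedBlock_shear (x : ∀ i, E i) (k : ι) :
    reducedBlock A N k (x k + ∑ i, N k i (x i)) =
      A k k (x k) - ∑ j, A k j (N j k (x k)) + ∑ i, if p i k then A k i (x i) else 0 := by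
  rw [reducedBlock_apply]
  simp only [map_add, map_sum, h.N_N, Finset.sum_const_zero, add_zero, h.A_N]
  abel

open Classical in
/-- The Schur complements as the result of block elimination, in terms of quadratic forms. -/
theorem sum_inner_reducedBlock (x : ∀ i, E i) :
    ∑ k, inner ℂ (x k + ∑ i, N k i (x i)) (reducedBlock A N k (x k + ∑ i, N k i (x i))) =
      ∑ k, inner ℂ (x k) (A k k (x k)) + ∑ k, ∑ i, if p i k ∨ p k i then
        inner ℂ (x k) (A k i (x i)) else 0 := by
  -- Completing the square. The last sum is arranged so that, once its two indices are exchanged, it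
  -- cancels the terms subtracted in the Schur complements; the two conditional sums are the paired
  -- off-diagonal blocks.
  have h1 : ∀ k, inner ℂ (x k + ∑ i, N k i (x i)) (reducedBlock A N k (x k + ∑ i, N k i (x i))) =
      inner ℂ (x k) (A k k (x k)) - ∑ i, inner ℂ (x k) (A k i (N i k (x k)))
        + ∑ i, (if p i k then inner ℂ (x k) (A k i (x i)) else 0)
        + (∑ i, (if p i k then inner ℂ (x i) (A i k (x k)) else 0)
          + ∑ i, inner ℂ (x i) (A i k (N k i (x i)))) := by
    intro k
    rw [h.reducedBlock_shear, inner_add_left, sum_inner, ← Finset.sum_add_distrib]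
    congr 1
    · rw [inner_add_right, inner_sub_right, inner_sum, inner_sum]
      congr 1
      refine Finset.sum_congr rfl fun i _ => ?_
      split_ifs <;> simp
    · refine Finset.sum_congr rfl fun i _ => ?_
      by_cases hik : p i k
      · rw [h.sum_paired i k hik, inner_add_right, inner_sub_right, h.symm, h.apply_N i k hik,
          if_pos hik, ← h.symm, h.symm i k (x i) (N k i (x i))]
        have : ∑ j, A k j (N j k (x k)) = 0 := Finset.sum_eq_zero fun j _ => by
          rw [h.N_eq_zero k j (h.not_chain i k j hik)]; simp
        rw [this, inner_zero_right, sub_zero, ← h.apply_N i k hik, h.symm k k]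
      · simp [h.N_eq_zero i k hik, hik]
  have h2 : ∀ k i, (if p i k ∨ p k i then inner ℂ (x k) (A k i (x i)) else 0) =
      (if p i k then inner ℂ (x k) (A k i (x i)) else 0) +
        (if p k i then inner ℂ (x k) (A k i (x i)) else 0) := by
    intro k i
    by_cases hik : p i k
    · simp [hik, h.not_chain i k i hik]
    · simp [hik]
  simp only [h1, h2, Finset.sum_add_distrib, Finset.sum_sub_distrib]
  rw [Finset.sum_comm (f := fun k i => inner ℂ (x i) (A i k (N k i (x i)))),
    Finset.sum_comm (f := fun k i => if p i k then inner ℂ (x i) (A i k (x k)) else 0)]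
  ring

end PairedBlocks

end Blocks

/-! ### Form estimates for the eliminated block operator. -/

section BlockEstimates

variable {ι : Type*} [Fintype ι] {E : ι → Type*} [∀ i, NormedAddCommGroup (E i)]
  [∀ i, InnerProductSpace ℂ (E i)]

/-- Quantitative bounds: the diagonal blocks are bounded below by `κ`, and controlled by the
Schur complements up to the factor `K`; the blocks between unpaired indices are small compared to
the diagonal ones, and the maps `N` are small. -/
structure PairedBounds (A N : ∀ i j, E j →ₗ[ℂ] E i) (p : ι → ι → Prop) (κ : ι → ℝ) (K η : ℝ) :
    Prop where
  κ_nonneg : ∀ i, 0 ≤ κ i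
  one_le_K : 1 ≤ K
  η_nonneg : 0 ≤ η
  coercive : ∀ i (x : E i), κ i * ‖x‖ ^ 2 ≤ (inner ℂ x (A i i x)).re
  unpaired : ∀ i j, i ≠ j → ¬ p i j → ¬ p j i → ∀ y, ‖A i j y‖ ≤ η * √(κ i * κ j) * ‖y‖
  norm_N_le : ∀ i j, p i j → ∀ x, ‖N j i x‖ ≤ η * ‖x‖
  le_reduced : ∀ i (x : E i), (inner ℂ x (A i i x)).re ≤ K * (inner ℂ x (reducedBlock A N i x)).re

namespace PairedBounds

variable {A N : ∀ i j, E j →ₗ[ℂ] E i} {p : ι → ι → Prop} {κ : ι → ℝ} {K η : ℝ}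
  (b : PairedBounds A N p κ K η) (h : PairedBlocks A N p)
include b

theorem K_pos : 0 < K := one_pos.trans_le b.one_le_K

theorem A_form_nonneg (i : ι) (x : E i) : 0 ≤ (inner ℂ x (A i i x)).re :=
  (mul_nonneg (b.κ_nonneg i) (sq_nonneg _)).trans (b.coercive i x)

theorem reduced_form_nonneg (i : ι) (x : E i) : 0 ≤ (inner ℂ x (reducedBlock A N i x)).re :=
  nonneg_of_mul_nonneg_right ((b.A_form_nonneg i x).trans (b.le_reduced i x)) b.K_pos

include h

/-- For a pair `p i k`, the relation `A k k ∘ N k i = A k i` identifies the energy of the correction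
`N k i (x i)` with what the Schur complement subtracts from `A i i`. -/
theorem sum_correction_le (x : ∀ i, E i) (k : ι) :
    κ k * ‖∑ i, N k i (x i)‖ ^ 2 ≤ ∑ i, (inner ℂ (x i) (A i k (N k i (x i)))).re := by
  classical
  refine (b.coercive k _).trans_eq ?_
  rw [map_sum, sum_inner, Complex.re_sum]
  refine Finset.sum_congr rfl fun i _ => ?_
  by_cases hik : p i k
  · simp only [h.A_N]
    rw [h.sum_paired i k hik, h.symm i k (x i), ← h.apply_N i k hik, h.symm k k]
  · simp [h.N_eq_zero i k hik]

/-- The Schur complement is nonnegative, so it subtracts at most the form of `A i i`, which is at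
most `K` times the reduced form. The shear does not change the component at the bottom of a pair. -/
theorem form_sub_reduced_le (x : ∀ i, E i) (i : ι) :
    ∑ k, (inner ℂ (x i) (A i k (N k i (x i)))).re ≤
      K * (inner ℂ (x i + ∑ j, N i j (x j))
        (reducedBlock A N i (x i + ∑ j, N i j (x j)))).re := by
  by_cases hi : ∃ j, p i j
  · obtain ⟨j, hj⟩ := hi
    have h0 : ∑ j, N i j (x j) = 0 := Finset.sum_eq_zero fun k _ => by
      rw [h.N_eq_zero k i fun hk => h.not_chain k i j hk hj]; rfl
    rw [h0, add_zero]
    refine le_trans ?_ (b.le_reduced i (x i))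
    have := b.reduced_form_nonneg i (x i)
    rw [reducedBlock_apply, inner_sub_right, Complex.sub_re, inner_sum, Complex.re_sum] at this
    linarith
  · push Not at hi
    rw [Finset.sum_eq_zero fun k _ => by rw [h.N_eq_zero i k (hi k)]; simp]
    exact mul_nonneg b.K_pos.le (b.reduced_form_nonneg i _)

/-- Coercivity in the unsheared variables. Each `x k` is the sheared component minus its correction,
and after summation each of these costs `2 * K` times the reduced form. -/
theorem sum_sq_le (x : ∀ i, E i) :
    ∑ k, κ k * ‖x k‖ ^ 2 ≤ 4 * K * ∑ k, (inner ℂ (x k + ∑ i, N k i (x i))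
        (reducedBlock A N k (x k + ∑ i, N k i (x i)))).re := by
  have h1 : ∀ k, κ k * ‖x k‖ ^ 2 ≤
      2 * (K * (inner ℂ (x k + ∑ i, N k i (x i))
        (reducedBlock A N k (x k + ∑ i, N k i (x i)))).re) +
      2 * ∑ i, (inner ℂ (x i) (A i k (N k i (x i)))).re := by
    intro k
    have h2 := b.sum_correction_le h x k
    have h3 := (b.coercive k (x k + ∑ i, N k i (x i))).trans (b.le_reduced k _)
    have h4 : ‖x k‖ ^ 2 ≤ 2 * ‖x k + ∑ i, N k i (x i)‖ ^ 2 + 2 * ‖∑ i, N k i (x i)‖ ^ 2 := by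
      have := norm_sub_le (x k + ∑ i, N k i (x i)) (∑ i, N k i (x i))
      rw [add_sub_cancel_right] at this
      have := pow_le_pow_left₀ (norm_nonneg _) this 2
      linarith [sq_nonneg (‖x k + ∑ i, N k i (x i)‖ - ‖∑ i, N k i (x i)‖)]
    have := mul_le_mul_of_nonneg_left h4 (b.κ_nonneg k)
    linarith
  refine (Finset.sum_le_sum fun k _ => h1 k).trans ?_
  rw [Finset.sum_add_distrib, ← Finset.mul_sum, ← Finset.mul_sum, ← Finset.mul_sum,
    Finset.sum_comm]
  have := Finset.sum_le_sum fun i (_ : i ∈ Finset.univ) => b.form_sub_reduced_le h x i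
  rw [← Finset.mul_sum] at this
  linarith

/-- After elimination only blocks between distinct unpaired indices are left over; `√(κ k * κ i)` is
split between the two components by the arithmetic-geometric inequality. -/
theorem abs_form_sub_le (x : ∀ i, E i) :
    |∑ k, ∑ i, (inner ℂ (x k) (A k i (x i))).re - ∑ k, (inner ℂ (x k + ∑ i, N k i (x i))
        (reducedBlock A N k (x k + ∑ i, N k i (x i)))).re| ≤
      η * Fintype.card ι * ∑ k, κ k * ‖x k‖ ^ 2 := by
  classical
  have h0 := congrArg Complex.re (h.sum_inner_reducedBlock x)
  simp only [Complex.add_re, Complex.re_sum, apply_ite Complex.re, Complex.zero_re] at h0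
  have h1 : ∀ k i, |(inner ℂ (x k) (A k i (x i))).re -
      (if k = i then (inner ℂ (x k) (A k i (x i))).re else 0) -
      (if p i k ∨ p k i then (inner ℂ (x k) (A k i (x i))).re else 0)| ≤
      η / 2 * (κ k * ‖x k‖ ^ 2 + κ i * ‖x i‖ ^ 2) := by
    intro k i
    have hnn : 0 ≤ η / 2 * (κ k * ‖x k‖ ^ 2 + κ i * ‖x i‖ ^ 2) := by
      have := b.η_nonneg
      have := b.κ_nonneg k
      have := b.κ_nonneg i
      positivity
    by_cases hki : k = i
    · subst hki
      simpa [h.not_refl k] using hnn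
    by_cases hp : p i k ∨ p k i
    · simpa [hki, hp] using hnn
    rw [if_neg hki, if_neg hp, sub_zero, sub_zero]
    rw [not_or] at hp
    have hb := b.unpaired k i hki hp.2 hp.1 (x i)
    have hκ := Real.sqrt_mul (b.κ_nonneg k) (κ i)
    calc |(inner ℂ (x k) (A k i (x i))).re| ≤ ‖x k‖ * ‖A k i (x i)‖ :=
          (Complex.abs_re_le_norm _).trans (norm_inner_le_norm _ _)
      _ ≤ ‖x k‖ * (η * √(κ k * κ i) * ‖x i‖) := by gcongr
      _ = η * ((√(κ k) * ‖x k‖) * (√(κ i) * ‖x i‖)) := by rw [hκ]; ring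
      _ ≤ η * (((√(κ k) * ‖x k‖) ^ 2 + (√(κ i) * ‖x i‖) ^ 2) / 2) := by
          refine mul_le_mul_of_nonneg_left ?_ b.η_nonneg
          linarith [two_mul_le_add_sq (√(κ k) * ‖x k‖) (√(κ i) * ‖x i‖)]
      _ = _ := by
          rw [mul_pow, mul_pow, Real.sq_sqrt (b.κ_nonneg k), Real.sq_sqrt (b.κ_nonneg i)]; ring
  have h2 : ∑ k, ∑ i, (inner ℂ (x k) (A k i (x i))).re - ∑ k, (inner ℂ (x k + ∑ i, N k i (x i))
        (reducedBlock A N k (x k + ∑ i, N k i (x i)))).re =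
      ∑ k, ∑ i, ((inner ℂ (x k) (A k i (x i))).re -
      (if k = i then (inner ℂ (x k) (A k i (x i))).re else 0) -
      (if p i k ∨ p k i then (inner ℂ (x k) (A k i (x i))).re else 0)) := by
    rw [h0]
    simp only [Finset.sum_sub_distrib, Finset.sum_ite_eq, Finset.mem_univ, if_true]
    ring
  rw [h2]
  refine (Finset.abs_sum_le_sum_abs _ _).trans ((Finset.sum_le_sum fun k _ =>
    (Finset.abs_sum_le_sum_abs _ _).trans (Finset.sum_le_sum fun i _ => h1 k i)).trans_eq ?_)
  simp only [← Finset.mul_sum, Finset.sum_add_distrib, Finset.sum_const, Finset.card_univ,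
    nsmul_eq_mul]
  simp only [mul_left_comm (κ _) (Fintype.card ι : ℝ), ← Finset.mul_sum]
  ring

/-- Each row and each column of `N` has at most one nonzero entry, so no cross terms appear. -/
theorem norm_sum_N_le (x : ∀ i, E i) :
    ∑ k, ‖∑ i, N k i (x i)‖ ^ 2 ≤ η ^ 2 * ∑ i, ‖x i‖ ^ 2 := by
  classical
  have h1 : ∀ k, ‖∑ i, N k i (x i)‖ ^ 2 = ∑ i, ‖N k i (x i)‖ ^ 2 := by
    intro k
    by_cases hk : ∃ i, p i k
    · obtain ⟨i, hi⟩ := hk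
      have h0 : ∀ j ≠ i, N k j (x j) = 0 := fun j hj => by
        rw [h.N_eq_zero j k fun hjk => hj (h.left_unique j i k hjk hi)]; rfl
      rw [Finset.sum_eq_single i (fun j _ hj => h0 j hj) (by simp),
        Finset.sum_eq_single i (fun j _ hj => by rw [h0 j hj]; simp) (by simp)]
    · push Not at hk
      have h0 : ∀ j, N k j (x j) = 0 := fun j => by rw [h.N_eq_zero j k (hk j)]; rfl
      simp [h0]
  simp only [h1]
  rw [Finset.sum_comm, Finset.mul_sum]
  refine Finset.sum_le_sum fun i _ => ?_
  by_cases hi : ∃ k, p i k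
  · obtain ⟨k, hk⟩ := hi
    rw [Finset.sum_eq_single k, ← mul_pow]
    · exact pow_le_pow_left₀ (norm_nonneg _) (b.norm_N_le i k hk _) 2
    · intro j _ hj
      rw [h.N_eq_zero i j fun hij => hj (h.right_unique i j k hij hk)]; simp
    · simp
  · push Not at hi
    rw [Finset.sum_eq_zero fun k _ => by rw [h.N_eq_zero i k (hi k)]; simp]
    positivity

end PairedBounds

end BlockEstimates

/-! ### Relative comparison of the spectra. -/

section BlockEigenvalues

variable {ι : Type*} [Fintype ι] {E : ι → Type*} [∀ i, NormedAddCommGroup (E i)]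
  [∀ i, InnerProductSpace ℂ (E i)] [∀ i, FiniteDimensional ℂ (E i)]

/-- The operator on a finite product of spaces that acts diagonally. -/
noncomputable def diagOp (M : ∀ i, Module.End ℂ (E i)) : Module.End ℂ (∀ i, E i) :=
  LinearMap.pi fun i => M i ∘ₗ LinearMap.proj i

theorem eigenvalueMultiset_neg_diagOp (M : ∀ i, Module.End ℂ (E i)) (hM : ∀ i, (M i).IsSymmetric) :
    eigenvalueMultiset (-(diagOp M)) = ∑ i, eigenvalueMultiset (-(M i)) := by
  classical
  have h1 := eigenvalueMultiset_of_basis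
    (Pi.basis fun i => ((hM i).eigenvectorBasis rfl).toBasis) (-(diagOp M))
    (fun s => -((hM s.1).eigenvalues rfl s.2 : ℂ)) (by
      rintro ⟨i, k⟩
      ext1 j
      rw [Pi.basis_apply]
      by_cases hij : j = i
      · subst hij
        simp [diagOp, (hM j).apply_eigenvectorBasis]
      · simp [diagOp, hij])
  rw [h1]
  simp only [(hM _).eigenvalueMultiset_neg rfl]
  rw [← Finset.univ_sigma_univ]
  change Multiset.map _ (Multiset.sigma _ _) = _
  rw [Multiset.sigma, Multiset.map_bind, Multiset.bind, Multiset.join]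
  simp only [Multiset.map_map, Function.comp_def]
  rfl

namespace PairedBounds

variable {A N : ∀ i j, E j →ₗ[ℂ] E i} {p : ι → ι → Prop} {κ : ι → ℝ} {K η : ℝ}
  (b : PairedBounds A N p κ K η) (h : PairedBlocks A N p)
include b h

/-- The form of `A` is that of the reduced operator composed with `1 + N`, up to a relative error `ζ
= 4 * K * card ι * η`. Both `1 + N` and its inverse have norm at most `1 + η`, so min-max applies in
both directions, and eigenvalues are matched by their rank. -/
theorem rel_eigenvalueMultiset (hη : η ≤ 1) (hζ : 4 * K * Fintype.card ι * η ≤ 1) :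
    Multiset.Rel (fun l μ : ℂ => ‖l - μ‖ ≤ (16 * K * Fintype.card ι + 3) * η * ‖μ‖)
      (eigenvalueMultiset (-(blockOp A))) (∑ i, eigenvalueMultiset (-(reducedBlock A N i))) := by
  -- The product type carries the sup norm; symmetry and min-max need the Hilbert sum.
  let e : PiLp 2 E ≃ₗ[ℂ] (∀ i, E i) := WithLp.linearEquiv 2 ℂ _
  let Ao : Module.End ℂ (PiLp 2 E) := e.symm.conj (blockOp A)
  let Mo : Module.End ℂ (PiLp 2 E) := e.symm.conj (diagOp (reducedBlock A N))
  have hAo : ∀ x i, Ao x i = ∑ j, A i j (x j) := fun x i => blockOp_apply A (e x) i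
  have hMo : ∀ x i, Mo x i = reducedBlock A N i (x i) := fun x i => rfl
  have sA : Ao.IsSymmetric := by
    intro x y
    simp only [PiLp.inner_apply, hAo, sum_inner, inner_sum]
    rw [Finset.sum_comm]
    simp only [h.symm]
  have sM : Mo.IsSymmetric := by
    intro x y
    simp only [PiLp.inner_apply, hMo]
    exact Finset.sum_congr rfl fun i _ => h.reducedBlock_symm i _ _
  have eA : eigenvalueMultiset (-(blockOp A)) = eigenvalueMultiset (-Ao) :=
    eigenvalueMultiset_conj e (-Ao) _ fun x => by simp [Ao]
  have eM : ∑ i, eigenvalueMultiset (-(reducedBlock A N i)) = eigenvalueMultiset (-Mo) := by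
    rw [← eigenvalueMultiset_neg_diagOp _ h.reducedBlock_symm]
    exact eigenvalueMultiset_conj e (-Mo) _ fun x => by simp [Mo]
  let No : Module.End ℂ (PiLp 2 E) := e.symm.conj (blockOp N)
  have hNo : ∀ x i, No x i = ∑ j, N i j (x j) := fun x i => blockOp_apply N (e x) i
  have hNN : ∀ x, No (No x) = 0 := by
    intro x
    ext k
    simp only [hNo, map_sum, h.N_N, Finset.sum_const_zero]
    rfl
  have nN : ∀ x, ‖No x‖ ≤ η * ‖x‖ := by
    intro x
    have h1 := b.norm_sum_N_le h (fun i => x i)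
    simp only [← hNo, ← PiLp.norm_sq_eq_of_L2, ← mul_pow] at h1
    exact le_of_sq_le_sq h1 (mul_nonneg b.η_nonneg (norm_nonneg _))
  have nT : ∀ x, ‖(1 + No) x‖ ^ 2 ≤ (1 + η) ^ 2 * ‖x‖ ^ 2 := by
    intro x
    rw [← mul_pow]
    refine pow_le_pow_left₀ (norm_nonneg _) ((norm_add_le _ _).trans ?_) 2
    rw [add_mul, one_mul]
    exact add_le_add le_rfl (nN x)
  have nS : ∀ x, ‖(1 - No) x‖ ^ 2 ≤ (1 + η) ^ 2 * ‖x‖ ^ 2 := by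
    intro x
    rw [← mul_pow]
    refine pow_le_pow_left₀ (norm_nonneg _) ((norm_sub_le _ _).trans ?_) 2
    rw [add_mul, one_mul]
    exact add_le_add le_rfl (nN x)
  have hTS : ∀ x, (1 + No) ((1 - No) x) = x := by
    intro x
    simp [LinearMap.add_apply, LinearMap.sub_apply, map_sub, hNN]
  have fM0 : ∀ y, 0 ≤ (inner ℂ y (Mo y)).re := by
    intro y
    simp only [PiLp.inner_apply, hMo, Complex.re_sum]
    exact Finset.sum_nonneg fun i _ => b.reduced_form_nonneg i _
  set ζ := 4 * K * Fintype.card ι * η with hζdef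
  have hζ0 : 0 ≤ ζ := by
    have := b.K_pos; have := b.η_nonneg; positivity
  have key : ∀ x, |(inner ℂ x (Ao x)).re - (inner ℂ ((1 + No) x) (Mo ((1 + No) x))).re| ≤
      ζ * (inner ℂ ((1 + No) x) (Mo ((1 + No) x))).re := by
    intro x
    have h1 := b.abs_form_sub_le h (fun i => x i)
    have h2 := mul_le_mul_of_nonneg_left (b.sum_sq_le h (fun i => x i))
      (mul_nonneg b.η_nonneg (Nat.cast_nonneg (α := ℝ) (Fintype.card ι)))
    have h3 : (inner ℂ x (Ao x)).re = ∑ k, ∑ i, (inner ℂ (x k) (A k i (x i))).re := by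
      simp only [PiLp.inner_apply, hAo, Complex.re_sum, inner_sum]
    have h4 : (inner ℂ ((1 + No) x) (Mo ((1 + No) x))).re =
        ∑ k, (inner ℂ (x k + ∑ i, N k i (x i))
          (reducedBlock A N k (x k + ∑ i, N k i (x i)))).re := by
      simp only [PiLp.inner_apply, hMo, Complex.re_sum, LinearMap.add_apply, Module.End.one_apply,
        PiLp.add_apply, hNo]
    rw [h3, h4]
    refine (h1.trans h2).trans_eq ?_
    rw [hζdef]; ring
  have up := fun k => sA.eigenvalues_le_of_form_le sM rfl rfl fM0 (1 + No) (α := 1 + ζ)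
    (by linarith) (fun x => by linarith [(abs_le.1 (key x)).2]) nT k
  have fA0 : ∀ x, 0 ≤ (inner ℂ x (Ao x)).re := fun x => by
    nlinarith [(abs_le.1 (key x)).1, fM0 ((1 + No) x)]
  have lam0 : ∀ k, 0 ≤ sA.eigenvalues rfl k := fun k => by
    have := fA0 (sA.eigenvectorBasis rfl k)
    rw [sA.apply_eigenvectorBasis, inner_smul_right] at this
    simpa using this
  have low : ∀ k, (1 - ζ) * sM.eigenvalues rfl k ≤ (1 + η) ^ 2 * sA.eigenvalues rfl k := by
    intro k
    -- For `ζ = 1` the factor `1 - ζ` cannot be inverted, but the bound is then trivial.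
    rcases hζ.eq_or_lt with h1 | h1
    · rw [h1, sub_self, zero_mul]
      exact mul_nonneg (by positivity) (lam0 k)
    · have h2 : 0 < 1 - ζ := by linarith
      have := sM.eigenvalues_le_of_form_le sA rfl rfl fA0 (1 - No) (α := (1 - ζ)⁻¹)
        (by positivity) (fun y => by
          have h3 := (abs_le.1 (key ((1 - No) y))).1
          rw [hTS] at h3
          rw [inv_mul_eq_div, le_div_iff₀ h2]
          linarith) nS k
      rw [mul_assoc, inv_mul_eq_div, le_div_iff₀ h2] at this
      linarith
  rw [eA, eM, sA.eigenvalueMultiset_neg rfl, sM.eigenvalueMultiset_neg rfl, Multiset.rel_map]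
  refine Multiset.rel_refl_of_refl_on fun k _ => ?_
  have μ0 : 0 ≤ sM.eigenvalues rfl k := by
    have := fM0 (sM.eigenvectorBasis rfl k)
    rw [sM.apply_eigenvectorBasis, inner_smul_right] at this
    simpa using this
  have h5 : ‖-(sA.eigenvalues rfl k : ℂ) - -(sM.eigenvalues rfl k : ℂ)‖ =
      |sA.eigenvalues rfl k - sM.eigenvalues rfl k| := by
    rw [← Complex.ofReal_neg, ← Complex.ofReal_neg, ← Complex.ofReal_sub, Complex.norm_real,
      Real.norm_eq_abs, abs_sub_comm]
    congr 1; ring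
  rw [h5, norm_neg, Complex.norm_real, Real.norm_of_nonneg μ0]
  -- For `η ≤ 1`, `(1 + η)² ≤ 1 + 3η` and `(1 + ζ)(1 + 3η) ≤ 1 + 4ζ + 3η`: this is the source of the
  -- constant.
  have h6 : (16 * K * Fintype.card ι + 3) * η = 4 * ζ + 3 * η := by rw [hζdef]; ring
  rw [h6]
  have u := up k
  have l := low k
  have l0 := lam0 k
  generalize sA.eigenvalues rfl k = lam at *
  generalize sM.eigenvalues rfl k = mu at *
  have hη0 := b.η_nonneg
  have q : (1 + η) ^ 2 ≤ 1 + 3 * η := by nlinarith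
  rw [abs_le]
  constructor
  · by_contra! hc
    have hlam : lam < (1 - 4 * ζ - 3 * η) * mu := by linarith
    have h7 := mul_lt_mul_of_pos_left hlam (show 0 < 1 + 3 * η by linarith)
    have h8 := mul_le_mul_of_nonneg_right q l0
    have h9 : (1 + 3 * η) * (1 - 4 * ζ - 3 * η) ≤ 1 - ζ := by nlinarith [mul_nonneg hζ0 hη0]
    have := mul_le_mul_of_nonneg_right h9 μ0
    linarith
  · have h7 : (1 + ζ) * (1 + η) ^ 2 ≤ 1 + 4 * ζ + 3 * η := by nlinarith [mul_nonneg hζ0 hη0]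
    have := mul_le_mul_of_nonneg_right h7 μ0
    linarith

end PairedBounds

end BlockEigenvalues

/-! ## Detailed balance and the symmetrised generator -/

namespace JumpData

variable {X : Type*} (S : JumpData X)

/-- The weight `m * exp (- V / ε)` of the reversible measure. -/
noncomputable def weight (ε : Set.Ioi (0 : ℝ)) (a : X) : ℝ := S.m a * Real.exp (-S.V a / ε)

theorem weight_pos (ε : Set.Ioi (0 : ℝ)) (a : X) : 0 < S.weight ε a :=
  mul_pos (S.m_pos a) (Real.exp_pos _)

theorem h_ne_bot (a b : X) : S.h a b ≠ ⊥ := ((bot_le).trans_lt (S.h_pos a b)).ne'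

theorem coe_toReal_h {a b : X} (h : S.h a b ≠ ⊤) : ((S.h a b).toReal : EReal) = S.h a b :=
  EReal.coe_toReal h (S.h_ne_bot a b)

theorem h_eq_top_comm (a b : X) : S.h a b = ⊤ ↔ S.h b a = ⊤ := by
  have key : ∀ a b, S.h a b = ⊤ → S.h b a = ⊤ := by
    intro a b h
    by_contra h'
    have := S.balance a b
    rw [h, ← S.coe_toReal_h h', ← EReal.coe_add, EReal.coe_add_top] at this
    exact EReal.coe_ne_top _ this.symm
  exact ⟨key a b, key b a⟩

theorem balance_toReal {a b : X} (h : S.h a b ≠ ⊤) :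
    S.V a + (S.h a b).toReal = S.V b + (S.h b a).toReal := by
  have := S.balance a b
  rw [← S.coe_toReal_h h, ← S.coe_toReal_h (mt (S.h_eq_top_comm a b).2 h)] at this
  exact_mod_cast this

theorem rate_nonneg (ε : Set.Ioi (0 : ℝ)) (a b : X) : 0 ≤ S.rate ε a b := by
  unfold rate
  split_ifs
  · exact le_rfl
  · have := S.c_pos a b
    have := S.m_pos a
    positivity

theorem rate_pos (ε : Set.Ioi (0 : ℝ)) {a b : X} (h : S.h a b ≠ ⊤) : 0 < S.rate ε a b := by
  rw [rate, if_neg h]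
  have := S.c_pos a b
  have := S.m_pos a
  positivity

theorem rate_self (ε : Set.Ioi (0 : ℝ)) (a : X) : S.rate ε a a = 0 := if_pos (S.h_self a)

theorem detailed_balance (ε : Set.Ioi (0 : ℝ)) (a b : X) :
    S.weight ε a * S.rate ε a b = S.weight ε b * S.rate ε b a := by
  by_cases h : S.h a b = ⊤
  · rw [rate, rate, if_pos h, if_pos ((S.h_eq_top_comm a b).1 h), mul_zero, mul_zero]
  · rw [rate, rate, if_neg h, if_neg (mt (S.h_eq_top_comm a b).2 h), weight, weight]
    have h1 : Real.exp (-S.V a / ε) * Real.exp (-(S.h a b).toReal / ε) =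
        Real.exp (-S.V b / ε) * Real.exp (-(S.h b a).toReal / ε) := by
      rw [← Real.exp_add, ← Real.exp_add, ← add_div, ← add_div, ← neg_add, ← neg_add,
        S.balance_toReal h]
    have ha := (S.m_pos a).ne'
    have hb := (S.m_pos b).ne'
    calc _ = S.c a b * (Real.exp (-S.V a / ε) * Real.exp (-(S.h a b).toReal / ε)) := by
          field_simp
      _ = S.c b a * (Real.exp (-S.V b / ε) * Real.exp (-(S.h b a).toReal / ε)) := by
          rw [h1, S.c_symm]
      _ = _ := by field_simp

section Generator

variable [Fintype X] [DecidableEq X]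

theorem generator_of_ne (ε : Set.Ioi (0 : ℝ)) {a b : X} (h : a ≠ b) :
    S.generator ε a b = S.rate ε a b := if_neg h

theorem generator_eq (ε : Set.Ioi (0 : ℝ)) (a b : X) :
    S.generator ε a b = S.rate ε a b - if a = b then ∑ k, S.rate ε a k else 0 := by
  by_cases h : a = b
  · subst h
    rw [generator, if_pos rfl, if_pos rfl, S.rate_self, zero_sub,
      Finset.sum_erase _ (S.rate_self ε a)]
  · rw [S.generator_of_ne ε h, if_neg h, sub_zero]

/-- The symmetric matrix similar to `-L`. -/
noncomputable def symMatrix (ε : Set.Ioi (0 : ℝ)) : Matrix X X ℝ :=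
  fun a b => -(√(S.weight ε a) / √(S.weight ε b) * S.generator ε a b)

theorem weight_mul_generator (ε : Set.Ioi (0 : ℝ)) (a b : X) :
    S.weight ε a * S.generator ε a b = S.weight ε b * S.generator ε b a := by
  by_cases h : a = b
  · rw [h]
  · rw [S.generator_of_ne ε h, S.generator_of_ne ε (Ne.symm h), S.detailed_balance]

theorem symMatrix_symm (ε : Set.Ioi (0 : ℝ)) (a b : X) :
    S.symMatrix ε a b = S.symMatrix ε b a := by
  have ha := Real.sqrt_pos.2 (S.weight_pos ε a)
  have hb := Real.sqrt_pos.2 (S.weight_pos ε b)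
  have h := S.weight_mul_generator ε a b
  rw [← Real.sq_sqrt (S.weight_pos ε a).le, ← Real.sq_sqrt (S.weight_pos ε b).le] at h
  rw [symMatrix, symMatrix, neg_inj, div_mul_eq_mul_div, div_mul_eq_mul_div,
    div_eq_div_iff hb.ne' ha.ne']
  linarith

/-- As a geometric mean, the entry has an exponent that is the average of `h a b` and `h b a`, hence
comparable with the exit exponents of both orbits at once. -/
theorem abs_symMatrix_of_ne (ε : Set.Ioi (0 : ℝ)) {a b : X} (h : a ≠ b) :
    |S.symMatrix ε a b| = √(S.rate ε a b * S.rate ε b a) := by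
  have ha := Real.sqrt_pos.2 (S.weight_pos ε a)
  have hb := Real.sqrt_pos.2 (S.weight_pos ε b)
  have hr := S.rate_nonneg ε a b
  rw [symMatrix, abs_neg, S.generator_of_ne ε h, abs_of_nonneg (by positivity)]
  symm
  rw [Real.sqrt_eq_iff_mul_self_eq (mul_nonneg hr (S.rate_nonneg ε b a)) (by positivity)]
  have h1 := S.detailed_balance ε a b
  have h2 := Real.sq_sqrt (S.weight_pos ε a).le
  have h3 := Real.sq_sqrt (S.weight_pos ε b).le
  rw [← h2, ← h3] at h1
  have h4 : S.rate ε b a = √(S.weight ε a) ^ 2 * S.rate ε a b / √(S.weight ε b) ^ 2 := by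
    rw [eq_div_iff (by positivity)]; linarith
  rw [h4]
  ring

/-- The symmetric operator similar to `-L`. -/
noncomputable def symOp (ε : Set.Ioi (0 : ℝ)) : Module.End ℂ (EuclideanSpace ℂ X) :=
  Matrix.toEuclideanLin ((S.symMatrix ε).map fun x : ℝ => (x : ℂ))

theorem symOp_apply (ε : Set.Ioi (0 : ℝ)) (z : EuclideanSpace ℂ X) (a : X) :
    S.symOp ε z a = ∑ b, (S.symMatrix ε a b : ℂ) * z b := by
  simp [symOp, Matrix.toLpLin_apply, Matrix.mulVec, dotProduct]

theorem inner_symOp (ε : Set.Ioi (0 : ℝ)) (x y : EuclideanSpace ℂ X) :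
    inner ℂ x (S.symOp ε y) =
      ∑ a, ∑ b, (S.symMatrix ε a b : ℂ) * (starRingEnd ℂ (x a) * y b) := by
  rw [PiLp.inner_apply]
  refine Finset.sum_congr rfl fun a _ => ?_
  rw [symOp_apply, RCLike.inner_apply, Finset.sum_mul]
  exact Finset.sum_congr rfl fun b _ => by ring

theorem symOp_isSymmetric (ε : Set.Ioi (0 : ℝ)) : (S.symOp ε).IsSymmetric := by
  intro x y
  rw [← inner_conj_symm, inner_symOp, inner_symOp, map_sum]
  simp only [map_sum]
  rw [Finset.sum_comm]
  refine Finset.sum_congr rfl fun a _ => ?_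
  refine Finset.sum_congr rfl fun b _ => ?_
  rw [map_mul, map_mul, Complex.conj_conj, Complex.conj_ofReal, mul_comm (y _), S.symMatrix_symm]

/-- The Dirichlet form. -/
theorem re_inner_symOp_self (ε : Set.Ioi (0 : ℝ)) (z : EuclideanSpace ℂ X) :
    (inner ℂ z (S.symOp ε z)).re = ∑ a, ∑ b, S.weight ε a * S.rate ε a b / 2 *
      ‖z a / (√(S.weight ε a) : ℂ) - z b / (√(S.weight ε b) : ℂ)‖ ^ 2 := by
  set w : X → ℝ := fun a => √(S.weight ε a) with hw
  have hw0 : ∀ a, w a ≠ 0 := fun a => (Real.sqrt_pos.2 (S.weight_pos ε a)).ne'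
  have hw2 : ∀ a, S.weight ε a = w a ^ 2 := fun a => (Real.sq_sqrt (S.weight_pos ε a).le).symm
  obtain ⟨f, hf⟩ : ∃ f : X → ℂ, ∀ a, z a = w a * f a :=
    ⟨fun a => z a / w a, fun a => by
      have : (w a : ℂ) ≠ 0 := by exact_mod_cast hw0 a
      field_simp⟩
  have hf' : ∀ a, z a / (w a : ℂ) = f a := fun a => by
    have : (w a : ℂ) ≠ 0 := by exact_mod_cast hw0 a
    rw [hf]; field_simp
  have h1 : ∀ a b, ((S.symMatrix ε a b : ℂ) * (starRingEnd ℂ (z a) * z b)).re =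
      (if a = b then ∑ k, S.weight ε a * S.rate ε a k * ‖f a‖ ^ 2 else 0) -
        S.weight ε a * S.rate ε a b * (starRingEnd ℂ (f a) * f b).re := by
    intro a b
    have e1 : ((S.symMatrix ε a b : ℂ) * (starRingEnd ℂ (z a) * z b)) =
        ((S.symMatrix ε a b * (w a * w b) : ℝ) : ℂ) * (starRingEnd ℂ (f a) * f b) := by
      rw [hf a, hf b, map_mul, Complex.conj_ofReal]; push_cast; ring
    have e2 : S.symMatrix ε a b * (w a * w b) = -(w a ^ 2 * S.generator ε a b) := by
      rw [symMatrix]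
      have := hw0 b
      change -(w a / w b * _) * _ = _
      field_simp
    rw [e1, e2, Complex.re_ofReal_mul, generator_eq, hw2]
    by_cases hab : a = b
    · subst hab
      have e3 : (starRingEnd ℂ (f a) * f a).re = ‖f a‖ ^ 2 := by
        rw [mul_comm, Complex.mul_conj, Complex.ofReal_re, Complex.normSq_eq_norm_sq]
      rw [if_pos rfl, if_pos rfl, ← Finset.sum_mul, ← Finset.mul_sum, e3]
      ring
    · rw [if_neg hab, if_neg hab]; ring
  have h2 : ∀ a b, S.weight ε a * S.rate ε a b / 2 * ‖f a - f b‖ ^ 2 =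
      (S.weight ε a * S.rate ε a b * ‖f a‖ ^ 2) / 2 + (S.weight ε b * S.rate ε b a * ‖f b‖ ^ 2) / 2
        - S.weight ε a * S.rate ε a b * (starRingEnd ℂ (f a) * f b).re := by
    intro a b
    have e4 : ‖f a - f b‖ ^ 2 = ‖f a‖ ^ 2 + ‖f b‖ ^ 2 - 2 * (starRingEnd ℂ (f a) * f b).re := by
      rw [← Complex.normSq_eq_norm_sq, ← Complex.normSq_eq_norm_sq, ← Complex.normSq_eq_norm_sq,
        Complex.normSq_sub]
      congr 2
      simp [mul_comm]
    rw [e4, ← S.detailed_balance ε a b]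
    ring
  rw [inner_symOp, Complex.re_sum]
  change _ = ∑ a, ∑ b, S.weight ε a * S.rate ε a b / 2 * ‖z a / (w a : ℂ) - z b / (w b : ℂ)‖ ^ 2
  simp only [Complex.re_sum, h1, hf', h2, Finset.sum_add_distrib, Finset.sum_sub_distrib,
    Finset.sum_ite_eq, Finset.mem_univ, if_true]
  rw [Finset.sum_comm (f := fun a b => S.weight ε b * S.rate ε b a * ‖f b‖ ^ 2 / 2)]
  simp only [← Finset.sum_div]
  ring

theorem re_inner_symOp_self_nonneg (ε : Set.Ioi (0 : ℝ)) (z : EuclideanSpace ℂ X) :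
    0 ≤ (inner ℂ z (S.symOp ε z)).re := by
  rw [re_inner_symOp_self]
  refine Finset.sum_nonneg fun a _ => Finset.sum_nonneg fun b _ => ?_
  have := S.weight_pos ε a
  have := S.rate_nonneg ε a b
  positivity

/-- The Dirichlet form of a function supported in a set is bounded below by the rate at which the
process leaves this set. -/
theorem le_re_inner_symOp_self (ε : Set.Ioi (0 : ℝ)) (s : Set X) (κ : ℝ)
    (hκ : ∀ a ∈ s, ∃ b ∉ s, κ ≤ S.rate ε a b) (z : EuclideanSpace ℂ X)
    (hz : ∀ a ∉ s, z a = 0) : κ * ‖z‖ ^ 2 ≤ (inner ℂ z (S.symOp ε z)).re := by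
  classical
  set w : X → ℝ := fun a => √(S.weight ε a) with hw
  have hw0 : ∀ a, w a ≠ 0 := fun a => (Real.sqrt_pos.2 (S.weight_pos ε a)).ne'
  have hw2 : ∀ a, S.weight ε a = w a ^ 2 := fun a => (Real.sq_sqrt (S.weight_pos ε a).le).symm
  -- Only pairs crossing the boundary of `s` are kept. There one of the two values of `z` vanishes
  -- and the Dirichlet term is explicit; by detailed balance both orientations contribute equally.
  let q : X → X → ℝ := fun a b => if a ∈ s ∧ b ∉ s then S.rate ε a b * ‖z a‖ ^ 2 else 0
  have hq : ∀ a b, (q a b + q b a) / 2 ≤ S.weight ε a * S.rate ε a b / 2 *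
      ‖z a / (w a : ℂ) - z b / (w b : ℂ)‖ ^ 2 := by
    intro a b
    have e : ∀ a, S.weight ε a * ‖z a / (w a : ℂ)‖ ^ 2 = ‖z a‖ ^ 2 := fun a => by
      have := hw0 a
      rw [norm_div, Complex.norm_real, div_pow, Real.norm_eq_abs, sq_abs, hw2]
      field_simp
    by_cases ha : a ∈ s <;> by_cases hb : b ∈ s
    · have := S.weight_pos ε a
      have := S.rate_nonneg ε a b
      simp only [q, ha, hb, not_true_eq_false, and_false, if_false, add_zero, zero_div]
      positivity
    · simp only [q, ha, hb, hz b hb, not_true_eq_false, not_false_eq_true, and_true, if_true,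
        and_false, if_false, add_zero, zero_div, sub_zero]
      rw [← e a]
      exact le_of_eq (by ring)
    · simp only [q, ha, hb, hz a ha, not_true_eq_false, not_false_eq_true, and_true, if_true,
        and_false, if_false, zero_add, zero_div, zero_sub, norm_neg]
      rw [S.detailed_balance, ← e b]
      exact le_of_eq (by ring)
    · have := S.weight_pos ε a
      have := S.rate_nonneg ε a b
      simp only [q, ha, hb, false_and, if_false, add_zero, zero_div]
      positivity
  rw [re_inner_symOp_self]
  refine le_trans ?_ (Finset.sum_le_sum fun a _ => Finset.sum_le_sum fun b _ => hq a b)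
  have h1 : ∑ a, ∑ b, (q a b + q b a) / 2 = ∑ a, ∑ b, q a b := by
    simp only [← Finset.sum_div, Finset.sum_add_distrib]
    rw [Finset.sum_comm (f := fun a b => q b a)]
    ring
  rw [h1, EuclideanSpace.norm_sq_eq, Finset.mul_sum]
  refine Finset.sum_le_sum fun a _ => ?_
  have hq0 : ∀ b, 0 ≤ q a b := fun b => by
    have := S.rate_nonneg ε a b
    simp only [q]; split_ifs <;> positivity
  by_cases ha : a ∈ s
  · obtain ⟨b, hb, hκb⟩ := hκ a ha
    refine le_trans ?_ (Finset.single_le_sum (fun b _ => hq0 b) (Finset.mem_univ b))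
    simp only [q, ha, hb, not_false_eq_true, and_self, if_true]
    gcongr
  · rw [hz a ha, norm_zero]
    have := Finset.sum_nonneg fun b (_ : b ∈ Finset.univ) => hq0 b
    simpa using this

end Generator

end JumpData

/-! ## Symmetry and exits from orbits -/

theorem exists_step_out {α : Type*} {r : α → α → Prop} {s : Set α} {a b : α}
    (h : Relation.ReflTransGen r a b) (ha : a ∈ s) (hb : b ∉ s) : ∃ x ∈ s, ∃ y ∉ s, r x y := by
  induction h with
  | refl => exact absurd ha hb
  | @tail x y _ hxy ih =>
    by_cases hx : x ∈ s
    · exact ⟨x, hx, y, hb, hxy⟩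
    · exact ih hx

namespace SymJumpData

variable {G X : Type*} [Group G] [MulAction G X] [Fintype X] [DecidableEq X]
  (S : SymJumpData G X)

theorem rate_smul (ε : Set.Ioi (0 : ℝ)) (g : G) (a b : X) :
    S.rate ε (g • a) (g • b) = S.rate ε a b := by
  by_cases h : a = b
  · rw [h, S.rate_self, S.rate_self]
  · rw [← S.generator_of_ne ε h, ← S.generator_of_ne ε (mt (MulAction.injective g).eq_iff.1 h),
      S.invariant]

/-- By irreducibility the increment `f (g • a) - f a` does not depend on `a`. Adding it along the
powers of `g` returns to the start after `|G|` steps, so it vanishes. Applied to the logarithm of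
the weight, this derives its invariance from that of the rates. -/
theorem map_smul_of_edge [Finite G] (f : X → ℝ)
    (hf : ∀ (g : G) (a b : X), S.h a b ≠ ⊤ → f (g • a) - f a = f (g • b) - f b) (g : G) (a : X) :
    f (g • a) = f a := by
  have h1 : ∀ a b, f (g • a) - f a = f (g • b) - f b := fun a b => by
    induction S.irreducible a b with
    | refl => rfl
    | tail _ hxy ih => exact ih.trans (hf g _ _ hxy)
  have h2 : ∀ n : ℕ, f (g ^ n • a) - f a = n * (f (g • a) - f a) := by
    intro n
    induction n with
    | zero => simp
    | succ n ih =>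
      rw [pow_succ', mul_smul]
      have := h1 (g ^ n • a) a
      push_cast
      linarith
  have h3 := h2 (Nat.card G)
  rw [pow_card_eq_one', one_smul, sub_self, eq_comm, mul_eq_zero] at h3
  have : (Nat.card G : ℝ) ≠ 0 := by exact_mod_cast Nat.card_pos.ne'
  exact sub_eq_zero.1 (h3.resolve_left this)

theorem log_weight_smul [Finite G] (ε : Set.Ioi (0 : ℝ)) (g : G) (a : X) :
    Real.log (S.weight ε (g • a)) = Real.log (S.weight ε a) := by
  refine S.map_smul_of_edge (fun a => Real.log (S.weight ε a)) (fun g a b hab => ?_) g a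
  have hba := mt (S.h_eq_top_comm a b).2 hab
  have h1 := S.detailed_balance ε (g • a) (g • b)
  have h2 := S.detailed_balance ε a b
  rw [S.rate_smul, S.rate_smul] at h1
  have hw := fun a => (S.weight_pos ε a).ne'
  have h1' := congrArg Real.log h1
  have h2' := congrArg Real.log h2
  rw [Real.log_mul (hw _) (S.rate_pos ε hab).ne', Real.log_mul (hw _) (S.rate_pos ε hba).ne']
    at h1' h2'
  linarith

theorem weight_smul [Finite G] (ε : Set.Ioi (0 : ℝ)) (g : G) (a : X) :
    S.weight ε (g • a) = S.weight ε a :=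
  Real.log_injOn_pos (S.weight_pos ε _) (S.weight_pos ε _) (S.log_weight_smul ε g a)

/-- Invariance of `log m - V / ε` at two values of `ε` separates `V` from `m`. -/
theorem V_smul [Finite G] (g : G) (a : X) : S.V (g • a) = S.V a := by
  have h := fun (ε : Set.Ioi (0 : ℝ)) => S.log_weight_smul ε g a
  have h1 := h ⟨1, Set.mem_Ioi.2 one_pos⟩
  have h2 := h ⟨2, Set.mem_Ioi.2 two_pos⟩
  simp only [JumpData.weight] at h1 h2
  rw [Real.log_mul (S.m_pos _).ne' (Real.exp_pos _).ne', Real.log_exp,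
    Real.log_mul (S.m_pos _).ne' (Real.exp_pos _).ne', Real.log_exp] at h1 h2
  simp only [div_one] at h1
  linarith

omit [Fintype X] [DecidableEq X] in
theorem exists_smul_of_mem {i : Orbits G X} {a b : X} (ha : a ∈ i.orbit) (hb : b ∈ i.orbit) :
    ∃ g : G, g • a = b := by
  rw [orbitRel.Quotient.mem_orbit] at ha hb
  exact orbitRel_apply.1 (Quotient.exact (hb.trans ha.symm))

theorem weight_eq_of_mem [Finite G] (ε : Set.Ioi (0 : ℝ)) {i : Orbits G X} {a b : X}
    (ha : a ∈ i.orbit) (hb : b ∈ i.orbit) : S.weight ε a = S.weight ε b := by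
  obtain ⟨g, rfl⟩ := exists_smul_of_mem ha hb
  exact (S.weight_smul ε g a).symm

theorem V_eq_of_mem [Finite G] {i : Orbits G X} {a b : X} (ha : a ∈ i.orbit) (hb : b ∈ i.orbit) :
    S.V a = S.V b := by
  obtain ⟨g, rfl⟩ := exists_smul_of_mem ha hb
  exact (S.V_smul g a).symm

omit [Fintype X] [DecidableEq X] in
theorem out_mem (i : Orbits G X) : Quotient.out i ∈ i.orbit := by
  rw [orbitRel.Quotient.mem_orbit]
  exact Quotient.out_eq i

omit [Fintype X] [DecidableEq X] in
theorem eq_of_mem_orbit {i j : Orbits G X} {a : X} (hi : a ∈ i.orbit) (hj : a ∈ j.orbit) :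
    i = j := by
  rw [orbitRel.Quotient.mem_orbit] at hi hj
  exact hi.symm.trans hj

omit [Fintype X] [DecidableEq X] in
theorem smul_mem_orbit_iff (g : G) {i : Orbits G X} {a : X} :
    g • a ∈ i.orbit ↔ a ∈ i.orbit := by
  rw [orbitRel.Quotient.mem_orbit, orbitRel.Quotient.mem_orbit]
  exact Eq.congr_left (orbitRel.Quotient.quotient_smul_eq (g := g) (a := a))

omit [Fintype X] [DecidableEq X] in
theorem exists_mem_orbit (a : X) : ∃ i : Orbits G X, a ∈ i.orbit :=
  ⟨Quotient.mk _ a, orbitRel.Quotient.mem_orbit.2 rfl⟩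

theorem hStar_le {i j : Orbits G X} {a b : X} (ha : a ∈ i.orbit) (hb : b ∈ j.orbit) :
    S.hStar i j ≤ S.h a b :=
  (iInf₂_le a ha).trans (iInf₂_le b hb)

theorem exists_h_eq_hStar (i j : Orbits G X) :
    ∃ a ∈ i.orbit, ∃ b ∈ j.orbit, S.h a b = S.hStar i j := by
  classical
  obtain ⟨⟨a, b⟩, hab, hmin⟩ := Finset.exists_min_image
    (Finset.univ.filter fun q : X × X => q.1 ∈ i.orbit ∧ q.2 ∈ j.orbit) (fun q => S.h q.1 q.2)
    ⟨(Quotient.out i, Quotient.out j), by simp [out_mem]⟩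
  simp only [Finset.mem_filter, Finset.mem_univ, true_and] at hab hmin
  refine ⟨a, hab.1, b, hab.2, le_antisymm ?_ (S.hStar_le hab.1 hab.2)⟩
  exact le_iInf₂ fun x hx => le_iInf₂ fun y hy => hmin (x, y) ⟨hx, hy⟩

/-! ### Successors, exit heights and cycles of orbits. -/

section Nontrivial

variable [Nontrivial (Orbits G X)]

theorem isSuccessor_succ (i : Orbits G X) : S.IsSuccessor i (S.succ i) := by
  classical
  have H : ∃ j, S.IsSuccessor i j := by
    let _ : Fintype (Orbits G X) := Fintype.ofFinite _
    obtain ⟨j₀, hj₀⟩ := exists_ne i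
    obtain ⟨j, hj, hmin⟩ := Finset.exists_min_image (Finset.univ.filter fun j => j ≠ i)
      (fun j => S.hStar i j) ⟨j₀, by simpa using hj₀⟩
    simp only [Finset.mem_filter, Finset.mem_univ, true_and] at hj hmin
    exact ⟨j, hj, hmin⟩
  rw [succ, dif_pos H]
  exact H.choose_spec

theorem hStar_succ_ne_top (i : Orbits G X) : S.hStar i (S.succ i) ≠ ⊤ := by
  obtain ⟨j, hj⟩ := exists_ne i
  obtain ⟨x, hx, y, hy, hxy⟩ := exists_step_out (s := i.orbit)
    (S.irreducible (Quotient.out i) (Quotient.out j)) (out_mem i)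
    (fun h => hj (eq_of_mem_orbit (out_mem j) h))
  obtain ⟨k, hyo⟩ := exists_mem_orbit (G := G) y
  have hne : k ≠ i := fun h => hy (h ▸ hyo)
  exact ne_top_of_le_ne_top hxy (((S.isSuccessor_succ i).2 _ hne).trans (S.hStar_le hx hyo))

/-- The exponent `h^*(i, s(i))` of the rate of exit from an orbit. -/
noncomputable def exitHeight (i : Orbits G X) : ℝ := (S.hStar i (S.succ i)).toReal

theorem coe_exitHeight (i : Orbits G X) : (S.exitHeight i : EReal) = S.hStar i (S.succ i) := by
  refine EReal.coe_toReal (S.hStar_succ_ne_top i) ?_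
  obtain ⟨a, _, b, _, h⟩ := S.exists_h_eq_hStar i (S.succ i)
  rw [← h]
  exact S.h_ne_bot a b

theorem exitHeight_le {i : Orbits G X} {a b : X} (ha : a ∈ i.orbit) (hb : b ∉ i.orbit) :
    (S.exitHeight i : EReal) ≤ S.h a b := by
  obtain ⟨k, hbo⟩ := exists_mem_orbit (G := G) b
  have hne : k ≠ i := fun h => hb (h ▸ hbo)
  rw [coe_exitHeight]
  exact ((S.isSuccessor_succ i).2 _ hne).trans (S.hStar_le ha hbo)

/-- An edge leaving `i` with the minimal exponent is an image under `G` of an edge between `i` and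
its successor, so it ends in the successor. -/
theorem exitHeight_lt (hS : S.NoAccidentalDegeneracy) {i : Orbits G X} {a b : X}
    (ha : a ∈ i.orbit) (hb : b ∉ i.orbit) (hb' : b ∉ (S.succ i).orbit) :
    (S.exitHeight i : EReal) < S.h a b := by
  refine lt_of_le_of_ne (S.exitHeight_le ha hb) fun h => ?_
  obtain ⟨a', ha', b', hb'', h'⟩ := S.exists_h_eq_hStar i (S.succ i)
  rw [coe_exitHeight, ← h'] at h
  obtain ⟨g, hg⟩ := hS a' b' a b (h' ▸ S.hStar_succ_ne_top i) h
  rcases Sym2.eq_iff.1 hg with ⟨_, h2⟩ | ⟨h1, _⟩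
  · exact hb' (h2 ▸ (smul_mem_orbit_iff g).2 hb'')
  · exact hb (h1 ▸ (smul_mem_orbit_iff g).2 ha')

theorem exists_exit (i : Orbits G X) :
    ∃ a ∈ i.orbit, ∃ b ∈ (S.succ i).orbit, S.h a b = S.exitHeight i := by
  obtain ⟨a, ha, b, hb, h⟩ := S.exists_h_eq_hStar i (S.succ i)
  exact ⟨a, ha, b, hb, h.trans (S.coe_exitHeight i).symm⟩

/-- `V` is constant on the orbit, so steps inside it do not shift the reference level, and the first
step out already costs the exit height. -/
theorem exitHeight_le_pathHeight [Finite G] {i : Orbits G X} {b : X} (hb : b ∉ i.orbit)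
    (l : List X) : ∀ a ∈ i.orbit, (S.exitHeight i : EReal) ≤ S.pathHeight a (l ++ [b]) := by
  induction l with
  | nil => exact fun a ha => (S.exitHeight_le ha hb).trans le_sup_left
  | cons k l ih =>
    intro a ha
    rw [List.cons_append, JumpData.pathHeight]
    by_cases hk : k ∈ i.orbit
    · by_cases h : S.h a k = ⊤
      · rw [h]; exact le_top.trans le_sup_left
      · refine le_trans ?_ le_sup_right
        have h1 := S.balance_toReal h
        rw [S.V_eq_of_mem ha hk, add_right_inj] at h1
        have h2 : S.h a k - S.h k a = 0 := by
          rw [← S.coe_toReal_h h, ← S.coe_toReal_h (mt (S.h_eq_top_comm a k).2 h), h1,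
            ← EReal.coe_sub, sub_self, EReal.coe_zero]
        rw [h2, zero_add]
        exact ih k hk
    · exact (S.exitHeight_le ha hk).trans le_sup_left

/-- With equal `V`, the exit edge from the later orbit back to the earlier one has the same exponent
in both directions. Reversed, it lets the earlier orbit escape at a height not above that needed by
the later one, against the gap `θ`. Hence every cycle of length 2 has a bottom. -/
theorem V_ne_of_cycle [Finite G] {θ : ℝ} (hθ : 0 < θ) (hS : S.HasMetastableOrder θ)
    {i j : Orbits G X} (hij : S.succ i = j) (hji : S.succ j = i) {a b : X} (ha : a ∈ i.orbit)
    (hb : b ∈ j.orbit) : S.V a ≠ S.V b := by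
  intro hV
  obtain ⟨A, hA⟩ := hS
  have hne : i ≠ j := fun h => (S.isSuccessor_succ i).1 (hij.trans h.symm)
  wlog hlt : A.symm i < A.symm j generalizing i j a b
  · exact this hji hij hb ha hV.symm hne.symm
      (lt_of_le_of_ne (not_lt.1 hlt) fun h => hne (A.symm.injective h).symm)
  have h1 := (hA (A.symm j) (lt_of_le_of_lt (Nat.zero_le _) hlt)).1 _ hlt
  rw [A.apply_symm_apply, A.apply_symm_apply] at h1
  have h2 : (S.exitHeight j : EReal) ≤
      S.setCommHeight j.orbit (⋃ l < A.symm j, (A l).orbit) := by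
    refine le_iInf₂ fun x hx => le_iInf₂ fun y hy => le_iInf fun l => ?_
    refine S.exitHeight_le_pathHeight (fun hyj => ?_) l x hx
    simp only [Set.mem_iUnion] at hy
    obtain ⟨l, hl, hyl⟩ := hy
    rw [← eq_of_mem_orbit hyl hyj, A.symm_apply_apply] at hl
    exact lt_irrefl _ hl
  obtain ⟨b', hb', a', ha', hj⟩ := S.exists_exit j
  rw [hji] at ha'
  have hV' : S.V a' = S.V b' := by
    rw [S.V_eq_of_mem ha' ha, S.V_eq_of_mem hb' hb, hV]
  have h3 : S.setCommHeight i.orbit ((⋃ l ≤ A.symm j, (A l).orbit) \ i.orbit) ≤ S.h a' b' := by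
    have hb'' : b' ∈ (⋃ l ≤ A.symm j, (A l).orbit) \ i.orbit := by
      refine ⟨?_, fun h => hne (eq_of_mem_orbit h hb')⟩
      simp only [Set.mem_iUnion]
      exact ⟨A.symm j, le_rfl, by rwa [A.apply_symm_apply]⟩
    refine (iInf₂_le a' ha').trans ((iInf₂_le b' hb'').trans ((iInf_le _ []).trans ?_))
    simp [JumpData.pathHeight]
  have htop : S.h b' a' ≠ ⊤ := hj ▸ EReal.coe_ne_top _
  have h4 : S.h a' b' = S.exitHeight j := by
    have h5 := S.balance_toReal htop
    rw [hV', add_right_inj] at h5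
    rw [← hj, ← S.coe_toReal_h htop, h5, S.coe_toReal_h (mt (S.h_eq_top_comm a' b').1 htop)]
  have h6 : (S.exitHeight j : EReal) + θ ≤ S.exitHeight j :=
    (add_le_add_left h2 _).trans (h1.trans (h3.trans_eq h4))
  rw [← EReal.coe_add, EReal.coe_le_coe_iff] at h6
  linarith

end Nontrivial

end SymJumpData

/-! ## The blocks in Euclidean coordinates -/

section EuclideanOrbitSpace

variable {G X W : Type*} [Group G] [Fintype G] [MulAction G X] [AddCommGroup W] [Module ℂ W]

theorem orbitSpace_apply_eq_zero (ρ : Representation ℂ G W) {i : Orbits G X}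
    (f : orbitSpace (X := X) ρ i) {a : X} (ha : a ∉ i.orbit) : (f : X → ℂ) a = 0 := by
  obtain ⟨f, x, rfl⟩ := f
  exact if_neg ha

/-- The space `P_i ℂ^X` with its Euclidean norm. -/
noncomputable abbrev euclideanOrbitSpace (ρ : Representation ℂ G W) (i : Orbits G X) :
    Submodule ℂ (EuclideanSpace ℂ X) :=
  (orbitSpace ρ i).map (WithLp.linearEquiv 2 ℂ (X → ℂ)).symm.toLinearMap

/-- A shortcut, to prevent the search from finding the inner product of a Hilbert module. -/
noncomputable instance euclideanOrbitSpace.instInner (ρ : Representation ℂ G W) (i : Orbits G X)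
    [Fintype X] : Inner ℂ (euclideanOrbitSpace (X := X) ρ i) :=
  (Submodule.innerProductSpace (euclideanOrbitSpace (X := X) ρ i)).toInner

/-- The identification of `P_i ℂ^X` with the same space with its Euclidean norm. -/
noncomputable def toEuclideanOrbitSpace (ρ : Representation ℂ G W) (i : Orbits G X) :
    orbitSpace (X := X) ρ i ≃ₗ[ℂ] euclideanOrbitSpace (X := X) ρ i :=
  LinearEquiv.submoduleMap _ _

theorem toEuclideanOrbitSpace_apply (ρ : Representation ℂ G W) (i : Orbits G X)
    (f : orbitSpace (X := X) ρ i) (a : X) :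
    (toEuclideanOrbitSpace ρ i f : EuclideanSpace ℂ X) a = (f : X → ℂ) a := rfl

theorem toEuclideanOrbitSpace_symm_apply (ρ : Representation ℂ G W) (i : Orbits G X)
    (x : euclideanOrbitSpace (X := X) ρ i) (a : X) :
    ((toEuclideanOrbitSpace ρ i).symm x : X → ℂ) a = (x : EuclideanSpace ℂ X) a := by
  rw [← toEuclideanOrbitSpace_apply, LinearEquiv.apply_symm_apply]

theorem euclideanOrbitSpace_apply_eq_zero (ρ : Representation ℂ G W) {i : Orbits G X}
    (x : euclideanOrbitSpace (X := X) ρ i) {a : X} (ha : a ∉ i.orbit) :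
    (x : EuclideanSpace ℂ X) a = 0 := by
  rw [← toEuclideanOrbitSpace_symm_apply]
  exact orbitSpace_apply_eq_zero ρ _ ha

end EuclideanOrbitSpace

namespace SymJumpData

variable {G X W : Type*} [Group G] [Fintype G] [MulAction G X] [Fintype X] [DecidableEq X]
  [AddCommGroup W] [Module ℂ W] (S : SymJumpData G X) (ρ : Representation ℂ G W)

theorem block_apply (ε : Set.Ioi (0 : ℝ)) (i j : Orbits G X) (f : orbitSpace (X := X) ρ j) (a : X)
    (ha : a ∈ i.orbit) :
    (S.block ρ ε i j f : X → ℂ) a = ∑ b, (S.generator ε a b : ℂ) * (f : X → ℂ) b := by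
  simp [block, orbitInd, ha, generatorOp, Matrix.mulVec, dotProduct]

/-- The square root of the weight of the states of an orbit. -/
noncomputable def sqrtWeight (ε : Set.Ioi (0 : ℝ)) (i : Orbits G X) : ℝ :=
  √(S.weight ε (Quotient.out i))

omit [Fintype G] in
theorem sqrtWeight_pos (ε : Set.Ioi (0 : ℝ)) (i : Orbits G X) : 0 < S.sqrtWeight ε i :=
  Real.sqrt_pos.2 (S.weight_pos ε _)

theorem sqrt_weight_eq (ε : Set.Ioi (0 : ℝ)) {i : Orbits G X} {a : X} (ha : a ∈ i.orbit) :
    √(S.weight ε a) = S.sqrtWeight ε i := by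
  rw [sqrtWeight, S.weight_eq_of_mem ε ha (out_mem i)]

omit [Fintype G] in
theorem sqrtWeight_ne_zero (ε : Set.Ioi (0 : ℝ)) (i : Orbits G X) :
    (S.sqrtWeight ε i : ℂ) ≠ 0 := by
  exact_mod_cast (S.sqrtWeight_pos ε i).ne'

/-- The blocks of the symmetrised operator `-L`. -/
noncomputable def symBlock (ε : Set.Ioi (0 : ℝ)) (i j : Orbits G X) :
    euclideanOrbitSpace (X := X) ρ j →ₗ[ℂ] euclideanOrbitSpace (X := X) ρ i :=
  -(S.sqrtWeight ε i / S.sqrtWeight ε j : ℂ) •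
    ((toEuclideanOrbitSpace ρ i).toLinearMap ∘ₗ S.block ρ ε i j ∘ₗ
      (toEuclideanOrbitSpace ρ j).symm.toLinearMap)

theorem symBlock_apply (ε : Set.Ioi (0 : ℝ)) (i j : Orbits G X)
    (y : euclideanOrbitSpace (X := X) ρ j) :
    S.symBlock ρ ε i j y = -(S.sqrtWeight ε i / S.sqrtWeight ε j : ℂ) •
      toEuclideanOrbitSpace ρ i (S.block ρ ε i j ((toEuclideanOrbitSpace ρ j).symm y)) := rfl

theorem symBlock_self_apply (ε : Set.Ioi (0 : ℝ)) (i : Orbits G X)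
    (y : euclideanOrbitSpace (X := X) ρ i) :
    S.symBlock ρ ε i i y = -
      toEuclideanOrbitSpace ρ i (S.block ρ ε i i ((toEuclideanOrbitSpace ρ i).symm y)) := by
  rw [symBlock_apply, div_self (S.sqrtWeight_ne_zero ε i), neg_one_smul]

/-- Constancy of the weight on orbits makes all the blocks compressions of one operator `symOp`;
symmetry and positivity are inherited from it. -/
theorem inner_symBlock (ε : Set.Ioi (0 : ℝ)) (i j : Orbits G X)
    (x : euclideanOrbitSpace (X := X) ρ i) (y : euclideanOrbitSpace (X := X) ρ j) :
    inner ℂ x (S.symBlock ρ ε i j y) =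
      inner ℂ (x : EuclideanSpace ℂ X) (S.symOp ε (y : EuclideanSpace ℂ X)) := by
  rw [Submodule.coe_inner, PiLp.inner_apply, PiLp.inner_apply]
  refine Finset.sum_congr rfl fun a _ => ?_
  by_cases ha : a ∈ i.orbit
  · congr 1
    rw [S.symOp_apply, symBlock_apply, Submodule.coe_smul, PiLp.smul_apply,
      toEuclideanOrbitSpace_apply, S.block_apply ρ ε i j _ a ha, smul_eq_mul, Finset.mul_sum]
    refine Finset.sum_congr rfl fun b _ => ?_
    rw [toEuclideanOrbitSpace_symm_apply]
    by_cases hb : b ∈ j.orbit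
    · rw [JumpData.symMatrix, S.sqrt_weight_eq ε ha, S.sqrt_weight_eq ε hb]
      push_cast
      ring
    · rw [euclideanOrbitSpace_apply_eq_zero ρ y hb, mul_zero, mul_zero, mul_zero]
  · rw [euclideanOrbitSpace_apply_eq_zero ρ x ha, inner_zero_left, inner_zero_left]

theorem symBlock_symm (ε : Set.Ioi (0 : ℝ)) (i j : Orbits G X)
    (x : euclideanOrbitSpace (X := X) ρ i) (y : euclideanOrbitSpace (X := X) ρ j) :
    inner ℂ x (S.symBlock ρ ε i j y) = inner ℂ (S.symBlock ρ ε j i x) y := by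
  rw [← inner_conj_symm (𝕜 := ℂ) (S.symBlock ρ ε j i x), inner_symBlock, inner_symBlock, inner_conj_symm,
    S.symOp_isSymmetric]

theorem le_re_inner_symBlock_self (ε : Set.Ioi (0 : ℝ)) (i : Orbits G X) (κ : ℝ)
    (hκ : ∀ a ∈ i.orbit, ∃ b ∉ i.orbit, κ ≤ S.rate ε a b) (x : euclideanOrbitSpace (X := X) ρ i) :
    κ * ‖x‖ ^ 2 ≤ (inner ℂ x (S.symBlock ρ ε i i x)).re := by
  rw [inner_symBlock]
  exact S.le_re_inner_symOp_self ε i.orbit κ hκ x fun a ha =>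
    euclideanOrbitSpace_apply_eq_zero ρ x ha

theorem norm_symBlock_le (ε : Set.Ioi (0 : ℝ)) {i j : Orbits G X} (hij : i ≠ j) (B : ℝ)
    (hB0 : 0 ≤ B) (hB : ∀ a ∈ i.orbit, ∀ b ∈ j.orbit, √(S.rate ε a b * S.rate ε b a) ≤ B)
    (y : euclideanOrbitSpace (X := X) ρ j) :
    ‖S.symBlock ρ ε i j y‖ ≤ Fintype.card X ^ 2 * B * ‖y‖ := by
  set v := S.symBlock ρ ε i j y with hv
  -- The image `v` is tested against itself, and the form is expanded into its matrix elements.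
  have h1 : ‖v‖ ^ 2 ≤ Fintype.card X ^ 2 * B * ‖y‖ * ‖v‖ := by
    have h2 : ‖v‖ ^ 2 = ‖inner ℂ (v : EuclideanSpace ℂ X) (S.symOp ε (y : EuclideanSpace ℂ X))‖ := by
      rw [← S.inner_symBlock ρ, ← hv, Submodule.coe_inner,
        inner_self_eq_norm_sq_to_K (𝕜 := ℂ), ← Submodule.coe_norm]
      simp
    rw [h2, S.inner_symOp]
    have h3 : ∀ a b, ‖(S.symMatrix ε a b : ℂ) *
        (starRingEnd ℂ ((v : EuclideanSpace ℂ X) a) * (y : EuclideanSpace ℂ X) b)‖ ≤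
        B * (‖v‖ * ‖y‖) := by
      intro a b
      by_cases ha : a ∈ i.orbit
      · by_cases hb : b ∈ j.orbit
        · have hab : a ≠ b := fun h => hij (eq_of_mem_orbit ha (h ▸ hb))
          rw [norm_mul, norm_mul, RCLike.norm_conj, Complex.norm_real, Real.norm_eq_abs,
            S.abs_symMatrix_of_ne ε hab]
          have e1 := PiLp.norm_apply_le (v : EuclideanSpace ℂ X) a
          have e2 := PiLp.norm_apply_le (y : EuclideanSpace ℂ X) b
          have e3 := hB a ha b hb
          exact mul_le_mul e3 (mul_le_mul e1 e2 (norm_nonneg _) (norm_nonneg _))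
            (by positivity) hB0
        · rw [euclideanOrbitSpace_apply_eq_zero ρ y hb, mul_zero, mul_zero, norm_zero]
          positivity
      · rw [euclideanOrbitSpace_apply_eq_zero ρ v ha, map_zero, zero_mul, mul_zero, norm_zero]
        positivity
    calc _ ≤ ∑ a : X, ∑ b : X, B * (‖v‖ * ‖y‖) :=
          (norm_sum_le _ _).trans (Finset.sum_le_sum fun a _ =>
            (norm_sum_le _ _).trans (Finset.sum_le_sum fun b _ => h3 a b))
      _ = _ := by
          simp only [Finset.sum_const, Finset.card_univ, nsmul_eq_mul]
          ring
  rcases (norm_nonneg v).eq_or_lt with h0 | h0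
  · rw [← h0]; positivity
  · rw [sq] at h1
    exact le_of_mul_le_mul_right h1 h0

/-- The relation between an orbit at the bottom of a cycle and its successor. -/
def IsBottomPair (i j : Orbits G X) : Prop := S.AtBottom i ∧ j = S.succ i

open Classical in
/-- The maps `(L_jj)⁻¹ L_ji` for orbits `i` at the bottom of a cycle and `j = s(i)`. -/
noncomputable def elimBlock (ε : Set.Ioi (0 : ℝ)) (j i : Orbits G X) :
    euclideanOrbitSpace (X := X) ρ i →ₗ[ℂ] euclideanOrbitSpace (X := X) ρ j :=
  if S.IsBottomPair i j then
    (S.sqrtWeight ε j / S.sqrtWeight ε i : ℂ) •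
      ((toEuclideanOrbitSpace ρ j).toLinearMap ∘ₗ
        (Ring.inverse (S.block ρ ε j j : Module.End ℂ (orbitSpace (X := X) ρ j))) ∘ₗ
        S.block ρ ε j i ∘ₗ (toEuclideanOrbitSpace ρ i).symm.toLinearMap)
  else 0

theorem elimBlock_apply (ε : Set.Ioi (0 : ℝ)) {i j : Orbits G X} (h : S.IsBottomPair i j)
    (x : euclideanOrbitSpace (X := X) ρ i) :
    S.elimBlock ρ ε j i x = (S.sqrtWeight ε j / S.sqrtWeight ε i : ℂ) •
      toEuclideanOrbitSpace ρ j
        (Ring.inverse (S.block ρ ε j j : Module.End ℂ (orbitSpace (X := X) ρ j))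
          (S.block ρ ε j i ((toEuclideanOrbitSpace ρ i).symm x))) := by
  rw [elimBlock, if_pos h]
  rfl

theorem elimBlock_eq_zero (ε : Set.Ioi (0 : ℝ)) {i j : Orbits G X} (h : ¬ S.IsBottomPair i j) :
    S.elimBlock ρ ε j i = 0 := if_neg h

theorem pairedBlocks (ε : Set.Ioi (0 : ℝ))
    (hu : ∀ i : Orbits G X, S.AtBottom i → IsUnit (S.block ρ ε (S.succ i) (S.succ i) :
        Module.End ℂ (orbitSpace (X := X) ρ (S.succ i)))) :
    PairedBlocks (E := fun i => ↥(euclideanOrbitSpace (X := X) ρ i))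
      (S.symBlock ρ ε) (S.elimBlock ρ ε) S.IsBottomPair where
  symm := S.symBlock_symm ρ ε
  right_unique i j k hj hk := hj.2.trans hk.2.symm
  left_unique i j k hi hj := by
    rw [← hi.1.2.1, ← hj.1.2.1, ← hi.2, ← hj.2]
  -- If the successor `j` of a bottom `i` were also a bottom, its successor would be `i` and `V`
  -- would be strictly ordered both ways.
  not_chain i j k hj hk := by
    obtain ⟨⟨h1, h2, h3⟩, rfl⟩ := hj
    have h4 := h3 _ (out_mem _) _ (out_mem _)
    have h5 := hk.1.2.2 _ (out_mem _) _ (out_mem _)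
    rw [h2] at h5
    exact lt_asymm h4 h5
  apply_N i j hij x := by
    obtain ⟨hi, rfl⟩ := hij
    rw [S.elimBlock_apply ρ ε ⟨hi, rfl⟩, map_smul, symBlock_self_apply, symBlock_apply,
      LinearEquiv.symm_apply_apply, ← Module.End.mul_apply, Ring.mul_inverse_cancel _ (hu i hi),
      Module.End.one_apply, smul_neg, neg_smul]
  N_eq_zero i j hij := S.elimBlock_eq_zero ρ ε hij

variable [Fintype (Orbits G X)]

/-- The symmetrised Schur complements (the diagonal blocks, away from the bottoms of cycles). -/
noncomputable abbrev symSchur (ε : Set.Ioi (0 : ℝ)) (i : Orbits G X) :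
    Module.End ℂ (euclideanOrbitSpace (X := X) ρ i) :=
  reducedBlock (E := fun i => ↥(euclideanOrbitSpace (X := X) ρ i)) (S.symBlock ρ ε)
    (S.elimBlock ρ ε) i

theorem symSchur_apply (ε : Set.Ioi (0 : ℝ)) (i : Orbits G X)
    (x : euclideanOrbitSpace (X := X) ρ i) :
    S.symSchur ρ ε i x = S.symBlock ρ ε i i x -
      ∑ j, S.symBlock ρ ε i j (S.elimBlock ρ ε j i x) :=
  reducedBlock_apply (E := fun i => ↥(euclideanOrbitSpace (X := X) ρ i)) (S.symBlock ρ ε)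
    (S.elimBlock ρ ε) i x

theorem symSchur_of_bottom (ε : Set.Ioi (0 : ℝ)) {i : Orbits G X} (hi : S.AtBottom i)
    (x : euclideanOrbitSpace (X := X) ρ i) :
    S.symSchur ρ ε i x =
      -toEuclideanOrbitSpace ρ i
        (S.schur ρ ε i (S.succ i) ((toEuclideanOrbitSpace ρ i).symm x)) := by
  classical
  rw [symSchur_apply, Finset.sum_eq_single (S.succ i), S.elimBlock_apply ρ ε ⟨hi, rfl⟩,
    map_smul, symBlock_self_apply, symBlock_apply, LinearEquiv.symm_apply_apply, smul_smul]
  · have h1 := S.sqrtWeight_ne_zero ε i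
    have h2 := S.sqrtWeight_ne_zero ε (S.succ i)
    have h3 : (S.sqrtWeight ε (S.succ i) / S.sqrtWeight ε i *
        -(S.sqrtWeight ε i / S.sqrtWeight ε (S.succ i)) : ℂ) = -1 := by
      field_simp
    rw [h3, neg_one_smul, schur, LinearMap.sub_apply, map_sub]
    simp only [LinearMap.comp_apply]
    abel
  · intro j _ hj
    rw [S.elimBlock_eq_zero ρ ε fun h => hj h.2]; simp
  · simp

theorem symSchur_of_not_bottom (ε : Set.Ioi (0 : ℝ)) {i : Orbits G X} (hi : ¬ S.AtBottom i) :
    S.symSchur ρ ε i = S.symBlock ρ ε i i := by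
  ext1 x
  rw [symSchur_apply, Finset.sum_eq_zero fun j _ => by
    rw [S.elimBlock_eq_zero ρ ε fun h => hi h.1]; simp, sub_zero]

/-- At a bottom, the form of the Schur complement at `x` is the form of `symOp` at `x - N x`. -/
theorem re_inner_symSchur_nonneg (ε : Set.Ioi (0 : ℝ))
    (h : PairedBlocks (E := fun i => ↥(euclideanOrbitSpace (X := X) ρ i))
      (S.symBlock ρ ε) (S.elimBlock ρ ε) S.IsBottomPair) (i : Orbits G X)
    (x : euclideanOrbitSpace (X := X) ρ i) :
    0 ≤ (inner ℂ x (S.symSchur ρ ε i x)).re := by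
  classical
  by_cases hi : S.AtBottom i
  · have h1 := S.re_inner_symOp_self_nonneg ε
      (x - S.elimBlock ρ ε (S.succ i) i x : EuclideanSpace ℂ X)
    have h2 := h.apply_N i (S.succ i) ⟨hi, rfl⟩ x
    rw [map_sub, inner_sub_left, inner_sub_right, inner_sub_right, ← S.inner_symBlock ρ,
      ← S.inner_symBlock ρ, ← S.inner_symBlock ρ, ← S.inner_symBlock ρ, h2, sub_self, sub_zero] at h1
    rw [symSchur_apply, Finset.sum_eq_single (S.succ i)]
    · exact h1.trans_eq (congrArg Complex.re (inner_sub_right x _ _).symm)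
    · intro j _ hj
      rw [S.elimBlock_eq_zero ρ ε fun h => hj h.2]; simp
    · simp
  · rw [S.symSchur_of_not_bottom ρ ε hi, inner_symBlock]
    exact S.re_inner_symOp_self_nonneg ε _

end SymJumpData

/-! ## The isotypic projectors -/

section Idempotent

variable {G X W : Type*} [Group G] [Fintype G] [MulAction G X] [AddCommGroup W] [Module ℂ W]

omit [Fintype G] in
theorem permOp_mul_permOp (g h : G) : permOp X g * permOp X h = permOp X (h * g) := by
  ext f a
  simp [permOp, LinearMap.funLeft_apply, mul_smul]

variable [FiniteDimensional ℂ W] (ρ : Representation ℂ G W) (hρ : ρ.IsIrreducible)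
include hρ

/-- The central element of the group algebra built from a character acts as a scalar. -/
theorem Representation.exists_sum_character_inv_smul_eq :
    ∃ c : ℂ, ∑ h : G, ρ.character h⁻¹ • ρ h = c • 1 := by
  let T : Representation.IntertwiningMap ρ ρ :=
    LinearMap.intertwiningMap_of_isIntertwiningMap ρ ρ (∑ h : G, ρ.character h⁻¹ • ρ h) (by
      intro g v
      simp only [LinearMap.sum_apply, LinearMap.smul_apply, map_sum, map_smul]
      refine Fintype.sum_equiv (MulAut.conj g⁻¹).toEquiv _ _ fun h => ?_
      have h1 : ρ.character (g⁻¹ * h * g)⁻¹ = ρ.character h⁻¹ := by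
        have := ρ.char_conj h⁻¹ g⁻¹
        rw [← this]
        congr 1
        group
      simp only [MulEquiv.toEquiv_eq_coe, MulEquiv.coe_toEquiv, MulAut.conj_apply, inv_inv, h1]
      rw [← Module.End.mul_apply, ← Module.End.mul_apply, ← map_mul, ← map_mul]
      congr 3
      group)
  obtain ⟨c, hc⟩ :=
    (Representation.IsIrreducible.algebraMap_intertwiningMap_bijective_of_isAlgClosed
      (ρ := ρ)).2 T
  refine ⟨c, ?_⟩
  ext v
  exact (DFunLike.congr_fun hc v).symm

/-- Multiplying the scalar identity by `ρ g` and taking traces gives `χ * χ = c χ`; evaluation at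
`1` and the orthonormality of characters give `c = |G| / d`. -/
theorem Representation.sum_character_mul_character (g : G) :
    (Module.finrank ℂ W : ℂ) * ∑ h : G, ρ.character h * ρ.character (g * h⁻¹) =
      Fintype.card G * ρ.character g := by
  obtain ⟨c, hc⟩ := ρ.exists_sum_character_inv_smul_eq hρ
  have h1 : ∀ g, ∑ h : G, ρ.character h * ρ.character (g * h⁻¹) = c * ρ.character g := by
    intro g
    have h2 := congrArg (fun T => LinearMap.trace ℂ W (T * ρ g)) hc
    simp only [Finset.sum_mul, smul_mul_assoc, ← map_mul, one_mul, map_sum, map_smul,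
      smul_eq_mul] at h2
    change ∑ h : G, ρ.character h⁻¹ * ρ.character (h * g) = c * ρ.character g at h2
    rw [← h2]
    refine Fintype.sum_equiv (Equiv.inv G) _ _ fun h => ?_
    rw [Equiv.inv_apply, inv_inv, ρ.char_mul_comm]
  have hcard : (Nat.card G : ℂ) ≠ 0 := by exact_mod_cast Nat.card_pos.ne'
  have : Invertible (Nat.card G : ℂ) := invertibleOfNonzero hcard
  have h3 := Representation.char_orthonormal ρ ρ
  rw [if_pos ⟨Representation.Equiv.refl ρ⟩, inv_mul_eq_one₀ hcard] at h3
  have h4 := h1 1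
  simp only [one_mul, Representation.char_one] at h4
  rw [h1, mul_left_comm, ← mul_assoc, ← h4, ← h3, Nat.card_eq_fintype_card]

theorem isIdempotentElem_isoProj : IsIdempotentElem (isoProj X ρ) := by
  have hd : (Module.finrank ℂ W : ℂ) ≠ 0 := by
    intro h0
    have h1 : Module.finrank ℂ W = 0 := by exact_mod_cast h0
    have := Module.finrank_zero_iff.1 h1
    obtain ⟨a, b, hab⟩ := hρ.toNontrivial
    exact hab (SetLike.ext fun x => by
      rw [Subsingleton.elim x 0]; exact iff_of_true (zero_mem a.toSubmodule) (zero_mem b.toSubmodule))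
  have hG : (Fintype.card G : ℂ) ≠ 0 := by exact_mod_cast Fintype.card_ne_zero
  have key : ∀ k : G, ∑ g : G, starRingEnd ℂ (LinearMap.trace ℂ W (ρ g)) *
      starRingEnd ℂ (LinearMap.trace ℂ W (ρ (k * g⁻¹))) =
      (Fintype.card G / Module.finrank ℂ W : ℂ) * starRingEnd ℂ (LinearMap.trace ℂ W (ρ k)) := by
    intro k
    have h := congrArg (starRingEnd ℂ) (ρ.sum_character_mul_character hρ k)
    simp only [map_mul, map_sum, map_natCast] at h
    rw [div_mul_eq_mul_div, eq_div_iff hd, mul_comm]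
    exact h
  rw [IsIdempotentElem, isoProj, smul_mul_smul_comm, Finset.sum_mul_sum]
  have h2 : ∑ g : G, ∑ h : G, ((starRingEnd ℂ (LinearMap.trace ℂ W (ρ g)) • permOp X g) *
      (starRingEnd ℂ (LinearMap.trace ℂ W (ρ h)) • permOp X h)) =
      ∑ k : G, ((Fintype.card G / Module.finrank ℂ W : ℂ) *
        starRingEnd ℂ (LinearMap.trace ℂ W (ρ k))) • permOp X k := by
    simp only [← key, Finset.sum_smul]
    rw [Finset.sum_comm (γ := G) (s := Finset.univ) (t := Finset.univ) (f := fun k g =>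
      (starRingEnd ℂ (LinearMap.trace ℂ W (ρ g)) *
      starRingEnd ℂ (LinearMap.trace ℂ W (ρ (k * g⁻¹)))) • permOp X k)]
    refine Finset.sum_congr rfl fun g _ => ?_
    -- `permOp` reverses products, hence the substitution `k = h * g`.
    refine Fintype.sum_equiv (Equiv.mulRight g) _ _ fun h => ?_
    rw [smul_mul_smul_comm, permOp_mul_permOp]
    simp
  rw [h2]
  simp only [mul_smul, ← Finset.smul_sum]
  have h3 : (Module.finrank ℂ W / Fintype.card G : ℂ) * (Module.finrank ℂ W / Fintype.card G) *
      (Fintype.card G / Module.finrank ℂ W) = Module.finrank ℂ W / Fintype.card G := by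
    field_simp
  rw [smul_smul, smul_smul, h3]

/-- `P_i` is idempotent, so its trace is the dimension of its range. -/
theorem orbitSpace_subsingleton [Fintype X] {i : Orbits G X} (hi : ¬ IsActive ρ i) :
    Subsingleton (orbitSpace (X := X) ρ i) := by
  have hP := isIdempotentElem_isoProj (X := X) ρ hρ
  have hind : orbitInd (G := G) (X := X) i * orbitInd i = orbitInd i := by
    ext f a
    by_cases ha : a ∈ i.orbit <;> simp [orbitInd, ha]
  have hcomm : isoProj X ρ * orbitInd i = orbitInd i * isoProj X ρ := by
    ext1 f
    exact isoProj_orbitInd ρ i f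
  have hid : IsIdempotentElem (orbitProj (X := X) ρ i) := by
    change (orbitInd i * isoProj X ρ) * (orbitInd i * isoProj X ρ) = orbitInd i * isoProj X ρ
    rw [mul_assoc, ← mul_assoc (isoProj X ρ), hcomm, mul_assoc (orbitInd i) (isoProj X ρ), hP,
      ← mul_assoc, hind]
  have ht := (LinearMap.IsIdempotentElem.isProj_range _ hid).trace
  rw [IsActive, ht, Complex.natCast_re, Nat.cast_pos, not_lt, Nat.le_zero,
    Module.finrank_zero_iff] at hi
  exact hi

end Idempotent

/-! ## Reduction to symmetric block operators -/

theorem exists_pos_forall_lt_of_finite {ι : Type*} [Finite ι] {P : ι → Set.Ioi (0 : ℝ) → Prop}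
    (h : ∀ i, ∃ ε₀ > (0 : ℝ), ∀ ε : Set.Ioi (0 : ℝ), (ε : ℝ) < ε₀ → P i ε) :
    ∃ ε₀ > (0 : ℝ), ∀ ε : Set.Ioi (0 : ℝ), (ε : ℝ) < ε₀ → ∀ i, P i ε := by
  rcases isEmpty_or_nonempty ι with hι | hι
  · exact ⟨1, one_pos, fun _ _ i => isEmptyElim i⟩
  · choose e he he' using h
    obtain ⟨i₀, hi₀⟩ := Finite.exists_min e
    exact ⟨e i₀, he i₀, fun ε hε i => he' i ε (hε.trans_le (hi₀ i))⟩

theorem exists_mul_exp_neg_div_le (C : ℝ) {θ δ : ℝ} (hθ : 0 < θ) (hδ : 0 < δ) :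
    ∃ ε₀ > (0 : ℝ), ∀ ε : Set.Ioi (0 : ℝ), (ε : ℝ) < ε₀ → C * Real.exp (-θ / ε) ≤ δ := by
  -- The threshold comes from `exp (-θ / ε) ≤ ε / θ`.
  refine ⟨δ * θ / (|C| + 1), by positivity, fun ε hε => ?_⟩
  have hε0 : (0 : ℝ) < ε := ε.2
  have h1 : Real.exp (-θ / ε) ≤ ε / θ := by
    rw [neg_div, Real.exp_neg, ← inv_div θ (ε : ℝ)]
    refine inv_anti₀ (by positivity) ?_
    linarith [Real.add_one_le_exp (θ / (ε : ℝ))]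
  rw [lt_div_iff₀ (by positivity)] at hε
  calc C * Real.exp (-θ / ε) ≤ (|C| + 1) * (ε / θ) :=
        mul_le_mul ((le_abs_self C).trans (by linarith)) h1 (Real.exp_pos _).le (by positivity)
    _ = ε * (|C| + 1) / θ := by ring
    _ ≤ δ := by rw [div_le_iff₀ hθ]; exact hε.le

namespace SymJumpData

variable {G X W : Type*} [Group G] [Fintype G] [MulAction G X] [Fintype X] [DecidableEq X]
  [AddCommGroup W] [Module ℂ W] (S : SymJumpData G X) (ρ : Representation ℂ G W)

/-- The components of a function in `P ℂ^X`, rescaled by the square root of the weight. -/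
noncomputable def orbitComponents (ε : Set.Ioi (0 : ℝ)) :
    isoSpace X ρ →ₗ[ℂ] ∀ i : Orbits G X, euclideanOrbitSpace (X := X) ρ i :=
  LinearMap.pi fun i => (S.sqrtWeight ε i : ℂ) • (toEuclideanOrbitSpace ρ i).toLinearMap ∘ₗ
    LinearMap.codRestrict (orbitSpace ρ i) (orbitInd i ∘ₗ (isoSpace X ρ).subtype) (by
      rintro ⟨_, f, rfl⟩
      exact ⟨f, rfl⟩)

theorem orbitComponents_apply (ε : Set.Ioi (0 : ℝ)) (f : isoSpace X ρ) (i : Orbits G X) (a : X) :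
    (S.orbitComponents ρ ε f i : EuclideanSpace ℂ X) a =
      S.sqrtWeight ε i * orbitInd i (f : X → ℂ) a := rfl

omit [Fintype G] [Fintype X] [DecidableEq X] in
theorem orbitInd_apply_of_mem {i : Orbits G X} {a : X} (ha : a ∈ i.orbit) (f : X → ℂ) :
    orbitInd i f a = f a := if_pos ha

omit [Fintype G] [Fintype X] [DecidableEq X] in
theorem orbitInd_apply_of_not_mem {i : Orbits G X} {a : X} (ha : a ∉ i.orbit) (f : X → ℂ) :
    orbitInd i f a = 0 := if_neg ha

omit [Fintype X] [DecidableEq X] in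
theorem orbitSpace_le_isoSpace (i : Orbits G X) : orbitSpace (X := X) ρ i ≤ isoSpace X ρ := by
  rintro _ ⟨f, rfl⟩
  exact ⟨orbitInd i f, isoProj_orbitInd ρ i f⟩

variable [Fintype (Orbits G X)]

omit [Fintype G] [Fintype X] [DecidableEq X] in
theorem sum_apply_of_mem {i : Orbits G X} {a : X} (ha : a ∈ i.orbit) (x : Orbits G X → X → ℂ)
    (hx : ∀ j, a ∉ j.orbit → x j a = 0) : ∑ j, x j a = x i a :=
  Finset.sum_eq_single i (fun j _ hj => hx j fun h => hj (eq_of_mem_orbit h ha)) (by simp)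

theorem orbitComponents_bijective (ε : Set.Ioi (0 : ℝ)) :
    Function.Bijective (S.orbitComponents ρ ε) := by
  constructor
  · rw [injective_iff_map_eq_zero]
    intro f hf
    ext a
    obtain ⟨i, hi⟩ := exists_mem_orbit (G := G) a
    have h1 := S.orbitComponents_apply ρ ε f i a
    rw [hf, orbitInd_apply_of_mem hi] at h1
    have h2 : (0 : ℂ) = S.sqrtWeight ε i * (f : X → ℂ) a := h1
    exact (mul_eq_zero.1 h2.symm).resolve_left (S.sqrtWeight_ne_zero ε i)
  · intro x
    refine ⟨∑ j, (S.sqrtWeight ε j : ℂ)⁻¹ •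
      ⟨(toEuclideanOrbitSpace ρ j).symm (x j), orbitSpace_le_isoSpace ρ j (Subtype.mem _)⟩, ?_⟩
    ext i a
    rw [orbitComponents_apply]
    by_cases ha : a ∈ i.orbit
    · rw [orbitInd_apply_of_mem ha]
      simp only [AddSubmonoidClass.coe_finsetSum, Submodule.coe_smul, Finset.sum_apply,
        Pi.smul_apply, toEuclideanOrbitSpace_symm_apply, smul_eq_mul]
      rw [sum_apply_of_mem ha (fun j a => (S.sqrtWeight ε j : ℂ)⁻¹ * (x j : EuclideanSpace ℂ X) a)
        fun j hj => by rw [euclideanOrbitSpace_apply_eq_zero ρ _ hj, mul_zero]]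
      rw [mul_inv_cancel_left₀ (S.sqrtWeight_ne_zero ε i)]
    · rw [orbitInd_apply_of_not_mem ha, mul_zero, euclideanOrbitSpace_apply_eq_zero ρ _ ha]

theorem eigenvalueMultiset_restricted (ε : Set.Ioi (0 : ℝ)) :
    eigenvalueMultiset (S.restricted ρ ε) =
      eigenvalueMultiset (-(blockOp (E := fun i => ↥(euclideanOrbitSpace (X := X) ρ i))
        (S.symBlock ρ ε))) := by
  refine (eigenvalueMultiset_conj (LinearEquiv.ofBijective _ (S.orbitComponents_bijective ρ ε))
    _ _ fun f => ?_).symm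
  rw [LinearEquiv.ofBijective_apply, LinearEquiv.ofBijective_apply, LinearMap.neg_apply]
  ext i a
  rw [orbitComponents_apply, Pi.neg_apply, blockOp_apply]
  by_cases ha : a ∈ i.orbit
  · rw [orbitInd_apply_of_mem ha]
    simp only [symBlock_apply, neg_smul, Finset.sum_neg_distrib, neg_neg,
      AddSubmonoidClass.coe_finsetSum, WithLp.ofLp_sum, Finset.sum_apply, Submodule.coe_smul,
      PiLp.smul_apply, toEuclideanOrbitSpace_apply, S.block_apply ρ ε i _ _ a ha,
      toEuclideanOrbitSpace_symm_apply, orbitComponents_apply, smul_eq_mul]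
    have h1 : ∀ j, (S.sqrtWeight ε i / S.sqrtWeight ε j : ℂ) * ∑ b, (S.generator ε a b : ℂ) *
        (S.sqrtWeight ε j * orbitInd j (f : X → ℂ) b) =
        S.sqrtWeight ε i * ∑ b, (S.generator ε a b : ℂ) * orbitInd j (f : X → ℂ) b := by
      intro j
      rw [Finset.mul_sum, Finset.mul_sum]
      refine Finset.sum_congr rfl fun b _ => ?_
      have := S.sqrtWeight_ne_zero ε j
      field_simp
    simp only [h1]
    rw [← Finset.mul_sum, Finset.sum_comm]
    congr 1
    have h2 : ((S.restricted ρ ε f : isoSpace X ρ) : X → ℂ) a =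
        ∑ b, (S.generator ε a b : ℂ) * (f : X → ℂ) b := by
      simp [restricted, generatorOp, Matrix.mulVec, dotProduct]
    rw [h2]
    refine Finset.sum_congr rfl fun b _ => ?_
    obtain ⟨k, hk⟩ := exists_mem_orbit (G := G) b
    rw [← Finset.mul_sum, sum_apply_of_mem hk (fun j => orbitInd j (f : X → ℂ))
      (fun j hj => orbitInd_apply_of_not_mem hj _), orbitInd_apply_of_mem hk]
  · rw [orbitInd_apply_of_not_mem ha, mul_zero]
    exact euclideanOrbitSpace_apply_eq_zero ρ _ ha

omit [Fintype (Orbits G X)] in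
theorem eigenvalueMultiset_neg_symBlock (ε : Set.Ioi (0 : ℝ)) (i : Orbits G X) :
    eigenvalueMultiset (-(S.symBlock ρ ε i i : Module.End ℂ (euclideanOrbitSpace (X := X) ρ i))) =
      eigenvalueMultiset (S.block ρ ε i i) :=
  eigenvalueMultiset_conj (toEuclideanOrbitSpace ρ i) _ _ fun f => by
    rw [LinearMap.neg_apply, symBlock_self_apply, neg_neg, LinearEquiv.symm_apply_apply]

theorem eigenvalueMultiset_neg_symSchur (ε : Set.Ioi (0 : ℝ)) {i : Orbits G X}
    (hi : S.AtBottom i) : eigenvalueMultiset (-(S.symSchur ρ ε i)) =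
      eigenvalueMultiset (S.schur ρ ε i (S.succ i)) :=
  eigenvalueMultiset_conj (toEuclideanOrbitSpace ρ i) _ _ fun f => by
    rw [LinearMap.neg_apply, S.symSchur_of_bottom ρ ε hi, neg_neg, LinearEquiv.symm_apply_apply]

omit [Fintype (Orbits G X)] in
theorem schur_of_subsingleton (ε : Set.Ioi (0 : ℝ)) (i j : Orbits G X)
    [Subsingleton (orbitSpace (X := X) ρ j)] : S.schur ρ ε i j = S.block ρ ε i i := by
  ext1 f
  rw [schur, LinearMap.sub_apply, LinearMap.comp_apply, LinearMap.comp_apply,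
    Subsingleton.elim (Ring.inverse (S.block ρ ε j j) (S.block ρ ε j i f))
      (0 : orbitSpace (X := X) ρ j), map_zero, sub_zero]

end SymJumpData

open Classical in
theorem SymJumpData.sum_eigenvalueMultiset_neg_symSchur {G X W : Type*} [Group G] [Fintype G]
    [MulAction G X] [Fintype X] [DecidableEq X] [AddCommGroup W] [Module ℂ W]
    [FiniteDimensional ℂ W] (S : SymJumpData G X) (ρ : Representation ℂ G W)
    (hρ : ρ.IsIrreducible) (ε : Set.Ioi (0 : ℝ)) :
    letI : Fintype (Orbits G X) := Fintype.ofFinite _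
    ∑ i : Orbits G X, eigenvalueMultiset (-(S.symSchur ρ ε i)) =
      S.schurEigenvalues ρ ε + S.blockEigenvalues ρ ε := by
  let _ : Fintype (Orbits G X) := Fintype.ofFinite _
  rw [schurEigenvalues, blockEigenvalues, ← Finset.sum_filter_add_sum_filter_not Finset.univ
    (fun i => S.AtBottom i ∧ IsActive ρ (S.succ i))]
  congr 1
  · refine Finset.sum_congr rfl fun i hi => ?_
    exact S.eigenvalueMultiset_neg_symSchur ρ ε (Finset.mem_filter.1 hi).2.1
  · refine Finset.sum_congr rfl fun i hi => ?_
    have hi := (Finset.mem_filter.1 hi).2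
    -- The elimination treats all bottoms alike. When the successor is inactive its space is zero,
    -- and the Schur complement is the diagonal block itself.
    by_cases hb : S.AtBottom i
    · have : Subsingleton (orbitSpace (X := X) ρ (S.succ i)) :=
        orbitSpace_subsingleton ρ hρ fun h => hi ⟨hb, h⟩
      rw [S.eigenvalueMultiset_neg_symSchur ρ ε hb, S.schur_of_subsingleton]
    · rw [S.symSchur_of_not_bottom ρ ε hb, S.eigenvalueMultiset_neg_symBlock]

/-! ## Asymptotic estimates -/

namespace JumpData

variable {X : Type*} [Finite X] (S : JumpData X)

theorem exists_rate_bounds : ∃ c₀ > (0 : ℝ), ∃ C₁ > (0 : ℝ), ∀ (ε : Set.Ioi (0 : ℝ)) (a b : X),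
    S.h a b ≠ ⊤ → c₀ * Real.exp (-(S.h a b).toReal / ε) ≤ S.rate ε a b ∧
      S.rate ε a b ≤ C₁ * Real.exp (-(S.h a b).toReal / ε) := by
  rcases isEmpty_or_nonempty X with hX | hX
  · exact ⟨1, one_pos, 1, one_pos, fun _ a => isEmptyElim a⟩
  · have hpos : ∀ q : X × X, 0 < S.c q.1 q.2 / S.m q.1 := fun q =>
      div_pos (S.c_pos _ _) (S.m_pos _)
    obtain ⟨q, hq⟩ := Finite.exists_min fun q : X × X => S.c q.1 q.2 / S.m q.1
    obtain ⟨r, hr⟩ := Finite.exists_max fun q : X × X => S.c q.1 q.2 / S.m q.1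
    refine ⟨_, hpos q, _, hpos r, fun ε a b hab => ?_⟩
    rw [rate, if_neg hab]
    exact ⟨mul_le_mul_of_nonneg_right (hq (a, b)) (Real.exp_pos _).le,
      mul_le_mul_of_nonneg_right (hr (a, b)) (Real.exp_pos _).le⟩

end JumpData

namespace SymJumpData

variable {G X W : Type*} [Group G] [Fintype G] [MulAction G X] [Fintype X] [DecidableEq X]
  [AddCommGroup W] [Module ℂ W] (S : SymJumpData G X) (ρ : Representation ℂ G W)

omit [Fintype G] in
/-- A uniform gap: between the smallest exponent of the exit from an orbit and the exponents of
the transitions to the orbits other than the successor, and between the two orbits of a cycle. -/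
theorem exists_gap [Nontrivial (Orbits G X)] (hS : S.NoAccidentalDegeneracy) :
    ∃ θ > (0 : ℝ),
      (∀ (i : Orbits G X) (a b : X), a ∈ i.orbit → b ∉ i.orbit → b ∉ (S.succ i).orbit →
        S.h a b ≠ ⊤ → S.exitHeight i + 2 * θ ≤ (S.h a b).toReal) ∧
      ∀ (i : Orbits G X) (a b : X), S.AtBottom i → a ∈ i.orbit → b ∈ (S.succ i).orbit →
        S.V a + 2 * θ ≤ S.V b := by
  -- The gap is written `2 * θ` because a geometric mean of two rates retains half of it.
  have aux : ∀ x y : ℝ, x < y → ∀ᶠ θ in 𝓝[>] (0 : ℝ), x + 2 * θ ≤ y := by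
    intro x y hxy
    filter_upwards [Ioo_mem_nhdsGT (show (0 : ℝ) < (y - x) / 2 by linarith)] with θ hθ
    linarith [hθ.2]
  have h1 : ∀ᶠ θ in 𝓝[>] (0 : ℝ), ∀ (i : Orbits G X) (a b : X), a ∈ i.orbit → b ∉ i.orbit →
      b ∉ (S.succ i).orbit → S.h a b ≠ ⊤ → S.exitHeight i + 2 * θ ≤ (S.h a b).toReal := by
    simp only [Filter.eventually_all]
    intro i a b ha hb hb' hab
    refine aux _ _ ?_
    have := S.exitHeight_lt hS ha hb hb'
    rw [← S.coe_toReal_h hab] at this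
    exact_mod_cast this
  have h2 : ∀ᶠ θ in 𝓝[>] (0 : ℝ), ∀ (i : Orbits G X) (a b : X), S.AtBottom i → a ∈ i.orbit →
      b ∈ (S.succ i).orbit → S.V a + 2 * θ ≤ S.V b := by
    simp only [Filter.eventually_all]
    intro i a b hi ha hb
    exact aux _ _ (hi.2.2 a ha b hb)
  obtain ⟨θ, ⟨h, h'⟩, hθ⟩ := ((h1.and h2).and self_mem_nhdsWithin).exists
  exact ⟨θ, hθ, h, h'⟩

omit [Fintype G] in
theorem exitHeight_le_toReal [Nontrivial (Orbits G X)] {i : Orbits G X} {a b : X}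
    (ha : a ∈ i.orbit) (hb : b ∉ i.orbit) (hab : S.h a b ≠ ⊤) :
    S.exitHeight i ≤ (S.h a b).toReal := by
  have := S.exitHeight_le ha hb
  rw [← S.coe_toReal_h hab] at this
  exact_mod_cast this

omit [Fintype G] in
theorem sqrt_rate_mul_rate_le {C₁ D : ℝ} (hC₁ : 0 < C₁) (ε : Set.Ioi (0 : ℝ)) {a b : X}
    (hC : ∀ a b : X, S.h a b ≠ ⊤ → S.rate ε a b ≤ C₁ * Real.exp (-(S.h a b).toReal / ε))
    (hD : S.h a b ≠ ⊤ → 2 * D ≤ (S.h a b).toReal + (S.h b a).toReal) :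
    √(S.rate ε a b * S.rate ε b a) ≤ C₁ * Real.exp (-D / ε) := by
  have hε : (0 : ℝ) < ε := ε.2
  refine Real.sqrt_le_iff.2 ⟨by positivity, ?_⟩
  by_cases hab : S.h a b = ⊤
  · rw [JumpData.rate, if_pos hab, zero_mul]; positivity
  · have hba := mt (S.h_eq_top_comm a b).2 hab
    calc _ ≤ (C₁ * Real.exp (-(S.h a b).toReal / ε)) * (C₁ * Real.exp (-(S.h b a).toReal / ε)) :=
          mul_le_mul (hC a b hab) (hC b a hba) (S.rate_nonneg ε b a) (by positivity)
      _ = C₁ ^ 2 * Real.exp (-((S.h a b).toReal + (S.h b a).toReal) / ε) := by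
          rw [mul_mul_mul_comm, ← Real.exp_add, sq]; congr 2; ring
      _ ≤ C₁ ^ 2 * Real.exp (-(2 * D) / ε) := by
          have := hD hab
          gcongr
      _ = (C₁ * Real.exp (-D / ε)) ^ 2 := by
          rw [mul_pow, ← Real.exp_nat_mul]; congr 2; push_cast; ring

-- Assumption 3 is expressed in the sup norm and the form arguments in the Euclidean norm; the
-- change costs a factor independent of `ε`.
omit [DecidableEq X] in
theorem exists_norm_toEuclidean_le : ∃ C > (0 : ℝ), ∀ (i : Orbits G X)
    (f : orbitSpace (X := X) ρ i), ‖toEuclideanOrbitSpace ρ i f‖ ≤ C * ‖f‖ ∧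
      ‖f‖ ≤ ‖toEuclideanOrbitSpace ρ i f‖ := by
  let T := (PiLp.continuousLinearEquiv 2 ℂ (fun _ : X => ℂ)).symm.toContinuousLinearMap
  refine ⟨‖T‖ + 1, by positivity, fun i f => ⟨?_, ?_⟩⟩
  · have h1 : ‖toEuclideanOrbitSpace ρ i f‖ = ‖T (f : X → ℂ)‖ := rfl
    rw [h1]
    refine (T.le_opNorm _).trans ?_
    rw [Submodule.coe_norm]
    exact mul_le_mul_of_nonneg_right (by linarith) (norm_nonneg _)
  · rw [Submodule.coe_norm, pi_norm_le_iff_of_nonneg (norm_nonneg _)]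
    intro a
    rw [← toEuclideanOrbitSpace_apply ρ i f a]
    exact PiLp.norm_apply_le _ a

variable [Fintype (Orbits G X)]

theorem symSchur_isSymmetric (ε : Set.Ioi (0 : ℝ))
    (h : PairedBlocks (E := fun i => ↥(euclideanOrbitSpace (X := X) ρ i))
      (S.symBlock ρ ε) (S.elimBlock ρ ε) S.IsBottomPair) (i : Orbits G X) :
    LinearMap.IsSymmetric (𝕜 := ℂ) (E := ↥(euclideanOrbitSpace (X := X) ρ i))
      (S.symSchur ρ ε i) := h.reducedBlock_symm i

/-- Turns the norm comparison of assumption 3 into an inequality of forms, through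
`form_le_of_norm_le` applied to a multiple of the Schur complement. -/
theorem exists_symBlock_le_symSchur (hcycles : S.NondegenerateCycles ρ) :
    ∃ K ≥ (1 : ℝ), ∃ ε₀ > (0 : ℝ), ∀ ε : Set.Ioi (0 : ℝ), (ε : ℝ) < ε₀ →
      PairedBlocks (E := fun i => ↥(euclideanOrbitSpace (X := X) ρ i))
        (S.symBlock ρ ε) (S.elimBlock ρ ε) S.IsBottomPair ∧
      ∀ (i : Orbits G X) (x : euclideanOrbitSpace (X := X) ρ i),
        (inner ℂ x (S.symBlock ρ ε i i x)).re ≤ K * (inner ℂ x (S.symSchur ρ ε i x)).re := by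
  obtain ⟨ε₁, hε₁, hu⟩ := exists_pos_forall_lt_of_finite (P := fun i ε => S.AtBottom i →
    IsUnit (S.block ρ ε (S.succ i) (S.succ i) :
        Module.End ℂ (orbitSpace (X := X) ρ (S.succ i)))) fun i => by
    by_cases hi : S.AtBottom i
    · obtain ⟨ε₀, h0, h⟩ := (hcycles i hi).1
      exact ⟨ε₀, h0, fun ε hε _ => h ε hε⟩
    · exact ⟨1, one_pos, fun _ _ h => absurd h hi⟩
  obtain ⟨C, hC, hnorm⟩ := exists_norm_toEuclidean_le (X := X) ρ
  have hK : ∀ i : Orbits G X, ∃ K ≥ (1 : ℝ), ∃ ε₀ > (0 : ℝ), ∀ ε : Set.Ioi (0 : ℝ), (ε : ℝ) < ε₀ →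
      PairedBlocks (E := fun i => ↥(euclideanOrbitSpace (X := X) ρ i))
        (S.symBlock ρ ε) (S.elimBlock ρ ε) S.IsBottomPair →
      ∀ x : euclideanOrbitSpace (X := X) ρ i,
        (inner ℂ x (S.symBlock ρ ε i i x)).re ≤ K * (inner ℂ x (S.symSchur ρ ε i x)).re := by
    intro i
    by_cases hi : S.AtBottom i
    · obtain ⟨K, hK, ε₀, hε₀, h⟩ := (hcycles i hi).2
      refine ⟨1 + C * K, le_add_of_nonneg_right (by positivity), ε₀, hε₀, fun ε hε hp x => ?_⟩
      have hs := S.symSchur_isSymmetric ρ ε hp i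
      have hnn := S.re_inner_symSchur_nonneg ρ ε hp i
      have hQ : ∀ y, (inner ℂ y (((C * K : ℝ) : ℂ) • S.symSchur ρ ε i y)).re =
          C * K * (inner ℂ y (S.symSchur ρ ε i y)).re := fun y => by
        rw [Submodule.coe_inner, Submodule.coe_smul, inner_smul_right, Complex.re_ofReal_mul,
          ← Submodule.coe_inner]
      have h1 := LinearMap.IsSymmetric.form_le_of_norm_le
        (P := (S.symBlock ρ ε i i : Module.End ℂ (euclideanOrbitSpace (X := X) ρ i)))
        (Q := ((C * K : ℝ) : ℂ) • S.symSchur ρ ε i)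
        (fun y z => (S.symBlock_symm ρ ε i i y z).symm)
        (hs.smul (by simp)) (fun y => by
          refine le_of_le_of_eq ?_ (hQ y).symm
          have := hnn y
          positivity)
        (fun y => by
          rw [LinearMap.smul_apply, norm_smul, Complex.norm_real,
            Real.norm_of_nonneg (by positivity), symBlock_self_apply,
            S.symSchur_of_bottom ρ ε hi, norm_neg, norm_neg]
          have h2 := (h ε hε ((toEuclideanOrbitSpace ρ i).symm y)).2
          have h3 := (hnorm i (S.block ρ ε i i ((toEuclideanOrbitSpace ρ i).symm y))).1
          have h4 := (hnorm i (S.schur ρ ε i (S.succ i) ((toEuclideanOrbitSpace ρ i).symm y))).2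
          calc _ ≤ C * (K * ‖S.schur ρ ε i (S.succ i) ((toEuclideanOrbitSpace ρ i).symm y)‖) :=
                h3.trans (mul_le_mul_of_nonneg_left h2 hC.le)
            _ ≤ _ := by
                rw [← mul_assoc]
                exact mul_le_mul_of_nonneg_left h4 (by positivity)) x
      have h5 : (inner ℂ x (S.symBlock ρ ε i i x)).re ≤
          C * K * (inner ℂ x (S.symSchur ρ ε i x)).re := le_of_le_of_eq h1 (hQ x)
      linarith [hnn x]
    · refine ⟨1, le_rfl, 1, one_pos, fun ε _ _ x => ?_⟩
      rw [S.symSchur_of_not_bottom ρ ε hi, one_mul]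
  choose K hK1 ε₂ hε₂ hK using hK
  obtain ⟨ε₃, hε₃, h3⟩ := exists_pos_forall_lt_of_finite (P := fun i ε => (ε : ℝ) < ε₂ i)
    fun i => ⟨ε₂ i, hε₂ i, fun _ h => h⟩
  have hKsum : ∀ i, K i ≤ 1 + ∑ i, K i := fun i => by
    have := Finset.single_le_sum (fun j _ => zero_le_one.trans (hK1 j)) (Finset.mem_univ i)
    linarith
  refine ⟨1 + ∑ i, K i, le_add_of_nonneg_right
    (Finset.sum_nonneg fun i _ => zero_le_one.trans (hK1 i)), min ε₁ ε₃, lt_min hε₁ hε₃,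
    fun ε hε => ?_⟩
  have hp := S.pairedBlocks ρ ε (hu ε (hε.trans_le (min_le_left _ _)))
  refine ⟨hp, fun i x => (hK i ε (h3 ε (hε.trans_le (min_le_right _ _)) i) hp x).trans ?_⟩
  exact mul_le_mul_of_nonneg_right (hKsum i) (S.re_inner_symSchur_nonneg ρ ε hp i x)

theorem exists_pairedBounds (hmeta : ∃ θ > (0 : ℝ), S.HasMetastableOrder θ)
    (hnondeg : S.NoAccidentalDegeneracy) (hcycles : S.NondegenerateCycles ρ) :
    ∃ θ > (0 : ℝ), ∃ C > (0 : ℝ), ∃ K ≥ (1 : ℝ), ∃ ε₀ > (0 : ℝ), ∀ ε : Set.Ioi (0 : ℝ),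
      (ε : ℝ) < ε₀ → PairedBlocks (E := fun i => ↥(euclideanOrbitSpace (X := X) ρ i))
        (S.symBlock ρ ε) (S.elimBlock ρ ε) S.IsBottomPair ∧
      ∃ κ, PairedBounds (E := fun i => ↥(euclideanOrbitSpace (X := X) ρ i))
        (S.symBlock ρ ε) (S.elimBlock ρ ε) S.IsBottomPair κ K (C * Real.exp (-θ / ε)) := by
  obtain ⟨K, hK, ε₀, hε₀, hsch⟩ := S.exists_symBlock_le_symSchur ρ hcycles
  rcases subsingleton_or_nontrivial (Orbits G X) with hO | hO
  -- With at most one orbit there are no off-diagonal blocks, and `κ = 0` suffices.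
  · refine ⟨1, one_pos, 1, one_pos, K, hK, ε₀, hε₀, fun ε hε => ⟨(hsch ε hε).1, 0, ?_⟩⟩
    exact
      { κ_nonneg := fun _ => le_rfl
        one_le_K := hK
        η_nonneg := by positivity
        coercive := fun i x => by
          rw [Pi.zero_apply, zero_mul]
          exact (S.re_inner_symOp_self_nonneg ε _).trans_eq
            (congrArg Complex.re (S.inner_symBlock ρ ε i i x x)).symm
        unpaired := fun i j hij => absurd (Subsingleton.elim i j) hij
        norm_N_le := fun i j hij => absurd (Subsingleton.elim _ _) hij.1.1
        le_reduced := (hsch ε hε).2 }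
  obtain ⟨c₀, hc₀, C₁, hC₁, hrate⟩ := S.exists_rate_bounds
  obtain ⟨θ, hθ, hgap, hV⟩ := S.exists_gap hnondeg
  obtain ⟨θ', hθ', hmeta⟩ := hmeta
  have hcard : 0 < Fintype.card X := by
    obtain ⟨i, _⟩ := exists_pair_ne (Orbits G X)
    exact Fintype.card_pos_iff.2 ⟨Quotient.out i⟩
  refine ⟨θ, hθ, Fintype.card X ^ 2 * (C₁ / c₀), by positivity, K, hK, ε₀, hε₀,
    fun ε hε => ⟨(hsch ε hε).1, fun i => c₀ * Real.exp (-S.exitHeight i / ε), ?_⟩⟩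
  have hε0 : (0 : ℝ) < ε := ε.2
  have hcoer : ∀ (i : Orbits G X) (x : euclideanOrbitSpace (X := X) ρ i),
      c₀ * Real.exp (-S.exitHeight i / ε) * ‖x‖ ^ 2 ≤ (inner ℂ x (S.symBlock ρ ε i i x)).re := by
    intro i
    -- The group moves one optimal exit edge to every state of the orbit, with the same rate.
    refine S.le_re_inner_symBlock_self ρ ε i _ fun a ha => ?_
    obtain ⟨a', ha', b', hb', hab⟩ := S.exists_exit i
    obtain ⟨g, rfl⟩ := exists_smul_of_mem ha' ha
    refine ⟨g • b', fun hb => ?_, ?_⟩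
    · exact (S.isSuccessor_succ i).1 (eq_of_mem_orbit hb' ((smul_mem_orbit_iff g).1 hb))
    · rw [S.rate_smul]
      have htop : S.h a' b' ≠ ⊤ := hab ▸ EReal.coe_ne_top _
      have h1 := (hrate ε a' b' htop).1
      rwa [hab, EReal.toReal_coe] at h1
  exact
    { κ_nonneg := fun i => by positivity
      one_le_K := hK
      η_nonneg := by positivity
      coercive := hcoer
      unpaired := fun i j hij hpij hpji y => by
        have h1 : ∀ a ∈ i.orbit, ∀ b ∈ j.orbit, √(S.rate ε a b * S.rate ε b a) ≤
            C₁ * Real.exp (-((S.exitHeight i + S.exitHeight j) / 2 + θ) / ε) := by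
          intro a ha b hb
          refine S.sqrt_rate_mul_rate_le hC₁ ε (fun a b hab => (hrate ε a b hab).2) fun hab => ?_
          have hba := mt (S.h_eq_top_comm a b).2 hab
          have hb' : b ∉ i.orbit := fun h => hij (eq_of_mem_orbit h hb)
          have ha' : a ∉ j.orbit := fun h => hij (eq_of_mem_orbit ha h)
          have e1 := S.exitHeight_le_toReal ha hb' hab
          have e2 := S.exitHeight_le_toReal hb ha' hba
          -- Mutual successors form a bottom pair in one of the two orders, which is excluded here.
          -- Otherwise one of the two exponents exceeds its exit height by `2 * θ`.
          by_cases hj : S.succ i = j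
          · by_cases hi : S.succ j = i
            · exfalso
              rcases (S.V_ne_of_cycle hθ' hmeta hj hi ha hb).lt_or_gt with h | h
              · refine hpij ⟨⟨by rw [hj]; exact hij.symm, by rw [hj, hi], fun x hx y hy => ?_⟩,
                  hj.symm⟩
                rw [hj] at hy
                rwa [S.V_eq_of_mem hx ha, S.V_eq_of_mem hy hb]
              · refine hpji ⟨⟨by rw [hi]; exact hij, by rw [hi, hj], fun x hx y hy => ?_⟩,
                  hi.symm⟩
                rw [hi] at hy
                rwa [S.V_eq_of_mem hx hb, S.V_eq_of_mem hy ha]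
            · linarith [hgap j b a hb ha' (fun h => hi (eq_of_mem_orbit h ha)) hba]
          · linarith [hgap i a b ha hb' (fun h => hj (eq_of_mem_orbit h hb)) hab]
        refine (S.norm_symBlock_le ρ ε hij _ (by positivity) h1 y).trans_eq ?_
        have h2 : √(c₀ * Real.exp (-S.exitHeight i / ε) * (c₀ * Real.exp (-S.exitHeight j / ε))) =
            c₀ * Real.exp (-((S.exitHeight i + S.exitHeight j) / 2) / ε) := by
          rw [Real.sqrt_eq_iff_mul_self_eq (by positivity) (by positivity)]
          have : Real.exp (-S.exitHeight i / ε) * Real.exp (-S.exitHeight j / ε) =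
              Real.exp (-((S.exitHeight i + S.exitHeight j) / 2) / ε) *
                Real.exp (-((S.exitHeight i + S.exitHeight j) / 2) / ε) := by
            rw [← Real.exp_add, ← Real.exp_add]; congr 1; ring
          linear_combination c₀ ^ 2 * this
        have h3 : Real.exp (-((S.exitHeight i + S.exitHeight j) / 2 + θ) / ε) =
            Real.exp (-θ / ε) * Real.exp (-((S.exitHeight i + S.exitHeight j) / 2) / ε) := by
          rw [← Real.exp_add]; congr 1; ring
        rw [h2, h3]
        field_simp
      norm_N_le := fun i j hij x => by
        obtain ⟨hi, rfl⟩ := hij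
        set j := S.succ i with hj
        -- Here `h b a = h a b + V a - V b ≥ h a b + 2 * θ`, so the averaged exponent is at least
        -- `exitHeight j + θ`. Coercivity of the block at `j`, tested on `u = N x`, then divides out
        -- `exp (-exitHeight j / ε)`.
        have h1 : ∀ a ∈ j.orbit, ∀ b ∈ i.orbit, √(S.rate ε a b * S.rate ε b a) ≤
            C₁ * Real.exp (-(S.exitHeight j + θ) / ε) := by
          intro a ha b hb
          refine S.sqrt_rate_mul_rate_le hC₁ ε (fun a b hab => (hrate ε a b hab).2) fun hab => ?_
          have e1 := S.exitHeight_le_toReal ha (fun h => hi.1 (eq_of_mem_orbit ha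
            (eq_of_mem_orbit hb h ▸ ha))) hab
          have e2 := S.balance_toReal hab
          have e3 := hV i b a hi hb ha
          linarith
        have h2 := S.norm_symBlock_le ρ ε hi.1 _ (by positivity) h1 x
        have h3 := hcoer j (S.elimBlock ρ ε j i x)
        rw [(hsch ε hε).1.apply_N i j ⟨hi, rfl⟩ x] at h3
        set u := S.elimBlock ρ ε j i x
        have h4 : (inner ℂ u (S.symBlock ρ ε j i x)).re ≤ ‖u‖ * ‖S.symBlock ρ ε j i x‖ :=
          (Complex.re_le_norm _).trans (norm_inner_le_norm _ _)
        have h5 : Real.exp (-(S.exitHeight j + θ) / ε) =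
            Real.exp (-θ / ε) * Real.exp (-S.exitHeight j / ε) := by
          rw [← Real.exp_add]; congr 1; ring
        rcases (norm_nonneg u).eq_or_lt with hu | hu
        · rw [← hu]; positivity
        have hκ : 0 < c₀ * Real.exp (-S.exitHeight j / ε) * ‖u‖ := by positivity
        refine le_of_mul_le_mul_left ?_ hκ
        calc c₀ * Real.exp (-S.exitHeight j / ε) * ‖u‖ * ‖u‖ =
              c₀ * Real.exp (-S.exitHeight j / ε) * ‖u‖ ^ 2 := by ring
          _ ≤ ‖u‖ * (Fintype.card X ^ 2 * (C₁ * Real.exp (-(S.exitHeight j + θ) / ε)) * ‖x‖) :=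
              h3.trans (h4.trans (mul_le_mul_of_nonneg_left h2 hu.le))
          _ = _ := by
              rw [h5]
              field_simp
      le_reduced := (hsch ε hε).2 }

end SymJumpData

theorem mainTheorem3 {G X W : Type*} [Group G] [Fintype G] [MulAction G X]
    [Fintype X] [DecidableEq X] [AddCommGroup W] [Module ℂ W] [FiniteDimensional ℂ W]
    (S : SymJumpData G X) (ρ : Representation ℂ G W) (hρ : ρ.IsIrreducible)
    (hd : 2 ≤ Module.finrank ℂ W)
    (hmeta : ∃ θ > (0 : ℝ), S.HasMetastableOrder θ)
    (hnondeg : S.NoAccidentalDegeneracy)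
    (hcycles : S.NondegenerateCycles ρ) :
    ∃ θ > (0 : ℝ), ∃ C > (0 : ℝ), ∃ ε₀ > (0 : ℝ), ∀ ε : Set.Ioi (0 : ℝ), (ε : ℝ) < ε₀ →
      Multiset.Rel (fun l μ : ℂ => ‖l - μ‖ ≤ C * Real.exp (-θ / ε) * ‖μ‖)
        (eigenvalueMultiset (S.restricted ρ ε))
        (S.schurEigenvalues ρ ε + S.blockEigenvalues ρ ε) := by
  let _ : Fintype (Orbits G X) := Fintype.ofFinite _
  obtain ⟨θ, hθ, C, hC, K, hK, ε₁, hε₁, hb⟩ := S.exists_pairedBounds ρ hmeta hnondeg hcycles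
  have hK0 : 0 < K := one_pos.trans_le hK
  -- These two thresholds ensure `η ≤ 1` and `ζ ≤ 1`, where `η = C * exp (-θ / ε)`.
  obtain ⟨ε₂, hε₂, h2⟩ := exists_mul_exp_neg_div_le C hθ one_pos
  obtain ⟨ε₃, hε₃, h3⟩ := exists_mul_exp_neg_div_le
    (4 * K * Fintype.card (Orbits G X) * C) hθ one_pos
  refine ⟨θ, hθ, (16 * K * Fintype.card (Orbits G X) + 3) * C, by positivity,
    min ε₁ (min ε₂ ε₃), lt_min hε₁ (lt_min hε₂ hε₃), fun ε hε => ?_⟩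
  obtain ⟨e1, e2, e3⟩ : (ε : ℝ) < ε₁ ∧ (ε : ℝ) < ε₂ ∧ (ε : ℝ) < ε₃ := by simpa using hε
  obtain ⟨hp, κ, hκ⟩ := hb ε e1
  have := hκ.rel_eigenvalueMultiset hp (h2 ε e2) (by rw [← mul_assoc]; exact h3 ε e3)
  rw [S.eigenvalueMultiset_restricted, ← S.sum_eigenvalueMultiset_neg_symSchur ρ hρ]
  simpa only [mul_assoc] using this
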